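/- **Conventions.** A *semisimplicial set* is a presheaf of sets on the category $\Delta_+$ of finite ordinals $[n]=\{0<\dots<n\}$, $n\ge 0$, and injective order-preserving maps; $\Delta^n$ denotes the presheaf represented by $[n]$. For $n\ge 1$ and $0\le k\le n$, the horn $\Lambda^n_k\subseteq\Delta^n$ consists of the $f\colon[m]\to[n]$ with $\operatorname{im}(f)\cup\{k\}\ne[n]$. A map of semisimplicial sets is a *fibration* if it has the right lifting property against all horn inclusions $\Lambda^n_k\to\Delta^n$ ($n\ge1$, $0\le k\le n$); a semisimplicial set $X$ is *fibrant* if the map $X\to 1$ to the terminal object is a fibration. The *geometric product* $A\otimes B$ has as $n$-simplices the jointly monic pairs of order-preserving surjections $p\colon[n]\to[a]$, $q\colon[n]\to[b]$ together with elements $x\in A_a$, $y\in B_b$; an injection $f\colon[n']\to[n]$ sends this to $(p',q',x f_0,y f_1)$, where $pf=f_0p'$ and $qf=f_1q'$ are the factorizations into a surjection followed by an injection. One has $\Delta^0\otimes X\cong X$. A *homotopy* $f_0\sim f_1$ between maps $f_0,f_1\colon X\to Y$ is a map $h\colon\Delta^1\otimes X\to Y$ whose restrictions along $\delta_\varepsilon\otimes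 X\colon X\cong\Delta^0\otimes X\to\Delta^1\otimes X$, where $\delta_\varepsilon\colon \Delta^0\to\Delta^1$ selects the vertex $\varepsilon$, are $f_\varepsilon$ for $\varepsilon=0,1$. A map $f\colon A\to B$ is a *homotopy equivalence* if there is $g\colon B\to A$ with homotopies $gf\sim\mathrm{id}_A$ and $fg\sim\mathrm{id}_B$. A *fibration category* is a category with two subcategories, of *weak equivalences* and of *fibrations*, each containing all isomorphisms, such that: 1. there is a terminal object, and for every object $A$ the map from $A$ to the terminal object is a fibration; 2. pullbacks along fibrations exist, and fibrations are stable under pullback; 3. trivial fibrations, i.e. fibrations that are weak equivalences, are stable under pullback; 4. every map factors as a weak equivalence followed by a fibration; 5. weak equivalences are closed under 2-out-of-6: for composable maps $f,g,h$, if $gf$ and $hg$ are weak equivalences, then so are $f$, $g$, $h$ and $hgf$. **Theorem.** The full subcategory of fibrant semisimplicial sets, with the homotopy equivalences as weak equivalences and the fibrations between fibrant objects as fibrations, is a fibration category. -/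

import Mathlib

open CategoryTheory CategoryTheory.Limits Opposite Simplicial

universe u v w

/-! ### Fibration categories -/

/-- A fibration category: a category with subcategories of weak equivalences `W` and of
fibrations `Fib`, both containing all isomorphisms, satisfying the axioms below. -/
structure IsFibrationCategory {C : Type v} [Category.{w} C] (W Fib : MorphismProperty C) :
    Prop where
  /-- weak equivalences form a subcategory (identities and compositions) -/
  weq_isMultiplicative : W.IsMultiplicative
  /-- isomorphisms are weak equivalences -/
  weq_of_isIso : ∀ {X Y : C} (f : X ⟶ Y), IsIso f → W f
  /-- fibrations form a subcategory (identities and compositions) -/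
  fib_isMultiplicative : Fib.IsMultiplicative
  /-- isomorphisms are fibrations -/
  fib_of_isIso : ∀ {X Y : C} (f : X ⟶ Y), IsIso f → Fib f
  /-- there is a terminal object -/
  hasTerminal : HasTerminal C
  /-- every object is fibrant -/
  fib_to_terminal : ∀ {T : C}, IsTerminal T → ∀ {X : C} (f : X ⟶ T), Fib f
  /-- pullbacks along fibrations exist -/
  hasPullback : ∀ {X Y S : C} (f : X ⟶ S) (p : Y ⟶ S), Fib p → HasPullback f p
  /-- fibrations are stable under pullback -/
  fib_pullback : Fib.IsStableUnderBaseChange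
  /-- trivial fibrations, i.e. fibrations that are weak equivalences, are stable under pullback -/
  trivFib_pullback : (Fib ⊓ W).IsStableUnderBaseChange
  /-- every map factors as a weak equivalence followed by a fibration -/
  factorization : ∀ {X Y : C} (f : X ⟶ Y),
    ∃ (Z : C) (i : X ⟶ Z) (p : Z ⟶ Y), W i ∧ Fib p ∧ i ≫ p = f
  /-- weak equivalences are closed under 2-out-of-6 -/
  weq_two_of_six : ∀ {A B C' D : C} (f : A ⟶ B) (g : B ⟶ C') (h : C' ⟶ D),
    W (f ≫ g) → W (g ≫ h) → W f ∧ W g ∧ W h ∧ W (f ≫ g ≫ h)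

/-! ### Semisimplicial sets -/

/-- Semisimplicial sets: presheaves on the semisimplex category, whose objects are the
`[n]` for `n ≥ 0` and whose morphisms are the order embeddings. -/
abbrev SemiSSet : Type (u + 1) := SemiSimplexCategoryᵒᵖ ⥤ Type u

namespace SemiSSet

/-- The semisimplex `Δⁿ`, i.e. the presheaf represented by `[n]`. -/
abbrev simplex (n : ℕ) : SemiSSet.{u} := uliftYoneda.{u}.obj ⦋n⦌ₛ

/-- A simplex `g : [m] ↪ [n]` of `Δⁿ` belongs to the horn `Λⁿ_k` if the union of `{k}` and the
image of `g` is not all of `[n]`. -/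
def MemHorn {n : ℕ} (k : Fin (n + 1)) {m : SemiSimplexCategory} (g : m ⟶ ⦋n⦌ₛ) : Prop :=
  Set.range (SemiSimplexCategory.homEquiv g) ∪ {k} ≠ Set.univ

lemma MemHorn.precomp {n : ℕ} {k : Fin (n + 1)} {l m : SemiSimplexCategory} (f : l ⟶ m)
    {g : m ⟶ ⦋n⦌ₛ} (hg : MemHorn k g) : MemHorn k (f ≫ g) := by
  intro h
  refine hg (Set.eq_univ_of_univ_subset (h.symm.subset.trans ?_))
  refine Set.union_subset_union_left _ ?_
  rw [SemiSimplexCategory.homEquiv_comp]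
  rintro _ ⟨x, rfl⟩
  exact ⟨SemiSimplexCategory.homEquiv f x, by rw [RelEmbedding.trans_apply]⟩

/-- The `k`-th horn `Λⁿ_k ⊆ Δⁿ`. -/
def horn (n : ℕ) (k : Fin (n + 1)) : Subfunctor (simplex.{u} n) where
  obj U := {s | MemHorn k (ULift.down s : U.unop ⟶ ⦋n⦌ₛ)}
  map {U V} f s hs := by
    have e : (ULift.down ((simplex.{u} n).map f s) : V.unop ⟶ ⦋n⦌ₛ) =
      f.unop ≫ ULift.down s := by simp
    rw [Set.mem_preimage, Set.mem_ofPred_eq, e]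
    exact MemHorn.precomp f.unop hs

/-- The horn inclusions `Λᵐ_k ⟶ Δᵐ` for `m = n + 1 ≥ 1` and `0 ≤ k ≤ m`. -/
def hornInclusions : MorphismProperty SemiSSet.{u} :=
  ⨆ n : ℕ, .ofHoms fun k : Fin (n + 2) => (horn.{u} (n + 1) k).ι

/-- Fibrations: maps with the right lifting property against all horn inclusions. -/
def fibrations : MorphismProperty SemiSSet.{u} := hornInclusions.{u}.rlp

/-- A semisimplicial set `X` is fibrant if `X ⟶ 1` is a fibration. -/
def IsFibrant : ObjectProperty SemiSSet.{u} := fun X => fibrations (terminal.from X)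

/-! ### The geometric product -/

section Factorization

open SemiSimplexCategory (toSimplexCategory)

variable {T : SimplexCategory} {c : SemiSimplexCategory} (φ : T ⟶ toSimplexCategory.obj c)

/-- The object `[m]` in the factorization `T ↠ [m] ↪ [c]` of a map of the simplex category. -/
noncomputable def factObj : SemiSimplexCategory := ⦋(image φ).len⦌ₛ

/-- The epimorphism in the factorization `T ↠ [m] ↪ [c]`. -/
noncomputable def factProj : T ⟶ toSimplexCategory.obj (factObj φ) := factorThruImage φ

/-- The monomorphism in the factorization `T ↠ [m] ↪ [c]`. -/
noncomputable def factIncl : factObj φ ⟶ c :=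
  @SemiSimplexCategory.homOfMono (factObj φ) c (image.ι φ) (inferInstanceAs (Mono (image.ι φ)))

instance epi_factProj : Epi (factProj φ) := inferInstanceAs (Epi (factorThruImage φ))

lemma map_factIncl : toSimplexCategory.map (factIncl φ) = image.ι φ :=
  @SemiSimplexCategory.toSimplexCategory_map_homOfMono (factObj φ) c (image.ι φ)
    (inferInstanceAs (Mono (image.ι φ)))

lemma fact_fac : factProj φ ≫ toSimplexCategory.map (factIncl φ) = φ := by
  rw [map_factIncl]
  exact image.fac φ

/-- Uniqueness of the factorization. -/
lemma fact_unique {d : SemiSimplexCategory} (p : T ⟶ toSimplexCategory.obj d) (hp : Epi p)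
    (i : d ⟶ c) (fac : p ≫ toSimplexCategory.map i = φ) :
    ∃ h : factObj φ = d, factProj φ ≫ eqToHom (congrArg toSimplexCategory.obj h) = p ∧
      factIncl φ = eqToHom h ≫ i := by
  obtain ⟨d⟩ := d
  have hi : Mono (toSimplexCategory.map i) := inferInstance
  have h : (image φ).len = d := congrArg SimplexCategory.len
    (@SimplexCategory.image_eq _ _ _ φ p hp (toSimplexCategory.map i) hi fac)
  subst h
  refine ⟨rfl, ?_, ?_⟩
  · refine (Category.comp_id _).trans ?_
    exact @SimplexCategory.factorThruImage_eq _ _ φ p hp (toSimplexCategory.map i) hi fac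
  · refine Eq.trans ?_ (Category.id_comp _).symm
    apply toSimplexCategory.map_injective
    rw [map_factIncl]
    exact @SimplexCategory.image_ι_eq _ _ φ p hp (toSimplexCategory.map i) hi fac

end Factorization

/-- An `S`-simplex of the free simplicial set on `A`: an epimorphism `p : S ↠ [a]` of the simplex
category together with an element of `A_a`. -/
structure FreeSimplex (A : SemiSSet.{u}) (S : SimplexCategory) : Type u where
  /-- the dimension `a` -/
  cod : SemiSimplexCategory
  /-- the epimorphism onto `[a]` -/
  proj : S ⟶ SemiSimplexCategory.toSimplexCategory.obj cod
  epi : Epi proj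
  /-- the element of `A_a` -/
  elt : A.obj (op cod)

namespace FreeSimplex

variable {A B : SemiSSet.{u}} {S T U : SimplexCategory}

/-- The simplicial action: for `f : T ⟶ S`, factor `f ≫ p` as an epimorphism `p'` followed by a
monomorphism `f₀`, and return `p'` together with the restriction of the element along `f₀`. -/
noncomputable def restrict (f : T ⟶ S) (z : FreeSimplex A S) : FreeSimplex A T where
  cod := factObj (f ≫ z.proj)
  proj := factProj (f ≫ z.proj)
  epi := inferInstance
  elt := A.map (factIncl (f ≫ z.proj)).op z.elt

/-- The restriction can be computed from any factorization into an epimorphism followed by a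
monomorphism. -/
lemma restrict_eq (f : T ⟶ S) (z : FreeSimplex A S) (c : SemiSimplexCategory)
    (p : T ⟶ SemiSimplexCategory.toSimplexCategory.obj c) (hp : Epi p) (i : c ⟶ z.cod)
    (fac : p ≫ SemiSimplexCategory.toSimplexCategory.map i = f ≫ z.proj) :
    z.restrict f = ⟨c, p, hp, A.map i.op z.elt⟩ := by
  obtain ⟨h, h₁, h₂⟩ := fact_unique _ p hp i fac
  subst h
  simp only [eqToHom_refl, Category.comp_id, Category.id_comp] at h₁ h₂
  subst h₁ h₂
  rfl

lemma restrict_fac (f : T ⟶ S) (z : FreeSimplex A S) :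
    ∃ i : (z.restrict f).cod ⟶ z.cod,
      (z.restrict f).proj ≫ SemiSimplexCategory.toSimplexCategory.map i = f ≫ z.proj ∧
      (z.restrict f).elt = A.map i.op z.elt :=
  ⟨factIncl (f ≫ z.proj), fact_fac _, rfl⟩

lemma restrict_id (z : FreeSimplex A S) : z.restrict (𝟙 S) = z := by
  rw [restrict_eq (𝟙 S) z z.cod z.proj z.epi (𝟙 _) (by simp)]
  simp

lemma restrict_comp (g : U ⟶ T) (f : T ⟶ S) (z : FreeSimplex A S) :
    z.restrict (g ≫ f) = (z.restrict f).restrict g := by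
  obtain ⟨i, hi, hi'⟩ := restrict_fac f z
  obtain ⟨j, hj, hj'⟩ := restrict_fac g (z.restrict f)
  rw [restrict_eq (g ≫ f) z _ ((z.restrict f).restrict g).proj
    ((z.restrict f).restrict g).epi (j ≫ i)
    (by rw [Functor.map_comp, reassoc_of% hj, hi, Category.assoc])]
  rw [op_comp, Functor.map_comp, types_comp_apply, ← hi', ← hj']

/-- The action of a map of semisimplicial sets. -/
def map (φ : A ⟶ B) (z : FreeSimplex A S) : FreeSimplex B S :=
  ⟨z.cod, z.proj, z.epi, φ.app _ z.elt⟩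

lemma map_restrict (φ : A ⟶ B) (f : T ⟶ S) (z : FreeSimplex A S) :
    (z.restrict f).map φ = (z.map φ).restrict f := by
  obtain ⟨i, hi, hi'⟩ := restrict_fac f z
  rw [restrict_eq f (z.map φ) (z.restrict f).cod (z.restrict f).proj (z.restrict f).epi i hi]
  simp only [map, hi']
  congr 1
  exact NatTrans.naturality_apply φ i.op z.elt

/-- The simplex given by the epimorphism `S ↠ [0]` and a vertex. -/
def ofVertex (a : A.obj (op ⦋0⦌ₛ)) (S : SimplexCategory) : FreeSimplex A S where
  cod := ⦋0⦌ₛ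
  proj := (default : S ⟶ ⦋0⦌)
  epi := SimplexCategory.epi_iff_surjective.2 (fun _ => ⟨0, Subsingleton.elim (α := Fin 1) _ _⟩)
  elt := a

lemma ofVertex_restrict (a : A.obj (op ⦋0⦌ₛ)) (f : T ⟶ S) :
    (ofVertex a S).restrict f = ofVertex a T := by
  rw [restrict_eq f (ofVertex a S) ⦋0⦌ₛ (ofVertex a T).proj (ofVertex a T).epi (𝟙 _)
    (Subsingleton.elim (α := T ⟶ ⦋0⦌) _ _)]
  exact congrArg (FreeSimplex.mk _ _ _) (ConcreteCategory.congr_hom (A.map_id (op ⦋0⦌ₛ)) a)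

/-- The simplex given by the identity `[n] ⟶ [n]` and an element of `A_n`. -/
def nondegenerate {n : SemiSimplexCategoryᵒᵖ} (x : A.obj n) :
    FreeSimplex A (SemiSimplexCategory.toSimplexCategory.obj n.unop) :=
  ⟨n.unop, 𝟙 _, inferInstance, x⟩

lemma nondegenerate_restrict {n m : SemiSimplexCategoryᵒᵖ} (x : A.obj n) (f : n ⟶ m) :
    (nondegenerate x).restrict (SemiSimplexCategory.toSimplexCategory.map f.unop) =
      nondegenerate (A.map f x) :=
  restrict_eq _ (nondegenerate x) m.unop (𝟙 _) inferInstance f.unop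
    ((Category.id_comp _).trans (Category.comp_id _).symm)

end FreeSimplex

/-- Two maps with the same domain are jointly monic. -/
def JointlyMono {C : Type v} [Category.{w} C] {X Y Z : C} (p : X ⟶ Y) (q : X ⟶ Z) : Prop :=
  ∀ ⦃T : C⦄ (s t : T ⟶ X), s ≫ p = t ≫ p → s ≫ q = t ≫ q → s = t

lemma JointlyMono.restrict {A B : SemiSSet.{u}} {S T : SimplexCategory}
    {x : FreeSimplex A S} {y : FreeSimplex B S} (h : JointlyMono x.proj y.proj)
    (f : T ⟶ S) [Mono f] : JointlyMono (x.restrict f).proj (y.restrict f).proj := by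
  intro _ s t hp hq
  obtain ⟨i, hi, -⟩ := x.restrict_fac f
  obtain ⟨j, hj, -⟩ := y.restrict_fac f
  rw [← cancel_mono f]
  apply h
  · rw [Category.assoc, Category.assoc, ← hi, reassoc_of% hp]
  · rw [Category.assoc, Category.assoc, ← hj, reassoc_of% hq]

/-- The geometric product `A ⊗ B`: an `n`-simplex is a jointly monic pair of epimorphisms
`p : [n] ↠ [a]` and `q : [n] ↠ [b]` of the simplex category together with elements of `A_a` and
`B_b`; a monomorphism `f` acts by factoring `f ≫ p` and `f ≫ q` into epimorphisms followed by
monomorphisms. -/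
noncomputable def geomProd (A B : SemiSSet.{u}) : SemiSSet.{u} where
  obj n := { z : FreeSimplex A (SemiSimplexCategory.toSimplexCategory.obj n.unop) ×
      FreeSimplex B (SemiSimplexCategory.toSimplexCategory.obj n.unop) //
    JointlyMono z.1.proj z.2.proj }
  map f := ↾fun z =>
    ⟨(z.1.1.restrict (SemiSimplexCategory.toSimplexCategory.map f.unop),
      z.1.2.restrict (SemiSimplexCategory.toSimplexCategory.map f.unop)), z.2.restrict _⟩
  map_id n := by
    refine ConcreteCategory.hom_ext _ _ fun z => ?_
    refine Subtype.ext (Prod.ext ?_ ?_)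
    · exact (congrArg (fun g => z.1.1.restrict g) (SemiSimplexCategory.toSimplexCategory.map_id _)).trans
        z.1.1.restrict_id
    · exact (congrArg (fun g => z.1.2.restrict g) (SemiSimplexCategory.toSimplexCategory.map_id _)).trans
        z.1.2.restrict_id
  map_comp f g := by
    refine ConcreteCategory.hom_ext _ _ fun z => ?_
    refine Subtype.ext (Prod.ext ?_ ?_)
    · exact (congrArg (fun g => z.1.1.restrict g) (Functor.map_comp _ _ _)).trans
        (z.1.1.restrict_comp _ _)
    · exact (congrArg (fun g => z.1.2.restrict g) (Functor.map_comp _ _ _)).trans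
        (z.1.2.restrict_comp _ _)

/-- The functorial action `φ ⊗ ψ` of the geometric product. -/
noncomputable def geomProdMap {A A' B B' : SemiSSet.{u}} (φ : A ⟶ A') (ψ : B ⟶ B') :
    geomProd A B ⟶ geomProd A' B' where
  app _ := ↾fun z => ⟨(z.1.1.map φ, z.1.2.map ψ), z.2⟩
  naturality _ _ f := by
    refine ConcreteCategory.hom_ext _ _ fun z => ?_
    exact Subtype.ext (Prod.ext (z.1.1.map_restrict φ _) (z.1.2.map_restrict ψ _))

/-- The (inverse) unit isomorphism `X ⟶ Δ⁰ ⊗ X`, sending `x ∈ X_n` to the pair of epimorphisms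
`[n] ↠ [0]` and `𝟙 : [n] ⟶ [n]` together with the vertex of `Δ⁰` and the element `x`. -/
noncomputable def toUnitProd (X : SemiSSet.{u}) : X ⟶ geomProd (simplex.{u} 0) X where
  app n := ↾fun x =>
    ⟨(FreeSimplex.ofVertex (ULift.up (𝟙 ⦋0⦌ₛ)) _, FreeSimplex.nondegenerate x),
      fun _ s t _ h => by simpa [FreeSimplex.nondegenerate] using h⟩
  naturality n m f := by
    refine ConcreteCategory.hom_ext _ _ fun x => ?_
    exact Subtype.ext (Prod.ext (FreeSimplex.ofVertex_restrict _ _).symm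
      (FreeSimplex.nondegenerate_restrict _ _).symm)

/-! ### Homotopies -/

/-- The endpoint inclusion `δ_ε : Δ⁰ ⟶ Δ¹` of the interval, selecting the vertex `ε`. -/
def endpoint (ε : Fin 2) : simplex.{u} 0 ⟶ simplex.{u} 1 :=
  uliftYoneda.{u}.map (SemiSimplexCategory.homEquiv.symm
    (OrderEmbedding.ofStrictMono (fun _ : Fin 1 => ε) (Subsingleton.strictMono _) :
      Fin 1 ↪o Fin 2))

/-- The restriction of `h : Δ¹ ⊗ X ⟶ Y` to `X ≅ Δ⁰ ⊗ X` along `δ_ε ⊗ X`. -/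
noncomputable def atEndpoint {X Y : SemiSSet.{u}} (h : geomProd (simplex.{u} 1) X ⟶ Y)
    (ε : Fin 2) : X ⟶ Y :=
  toUnitProd X ≫ geomProdMap (endpoint ε) (𝟙 X) ≫ h

/-- `f₀ ∼ f₁`: there is a homotopy `h : Δ¹ ⊗ X ⟶ Y` restricting to `f₀` and `f₁`. -/
def Homotopic {X Y : SemiSSet.{u}} (f₀ f₁ : X ⟶ Y) : Prop :=
  ∃ h : geomProd (simplex.{u} 1) X ⟶ Y, atEndpoint h 0 = f₀ ∧ atEndpoint h 1 = f₁

/-- Homotopy equivalences: maps `f : A ⟶ B` admitting `g : B ⟶ A` with `g ∘ f ∼ id` and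
`f ∘ g ∼ id`. -/
def homotopyEquivalences : MorphismProperty SemiSSet.{u} := fun A B f =>
  ∃ g : B ⟶ A, Homotopic (f ≫ g) (𝟙 A) ∧ Homotopic (g ≫ f) (𝟙 B)

end SemiSSet

/-- The full subcategory of fibrant semisimplicial sets. -/
abbrev FibrantSemiSSet : Type (u + 1) := SemiSSet.IsFibrant.{u}.FullSubcategory

namespace FibrantSemiSSet

/-- Weak equivalences of fibrant semisimplicial sets: the homotopy equivalences. -/
def weakEquivalences : MorphismProperty FibrantSemiSSet.{u} :=
  SemiSSet.homotopyEquivalences.{u}.inverseImage SemiSSet.IsFibrant.{u}.ι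

/-- Fibrations of fibrant semisimplicial sets: the fibrations between the underlying objects. -/
def fibrations : MorphismProperty FibrantSemiSSet.{u} :=
  SemiSSet.fibrations.{u}.inverseImage SemiSSet.IsFibrant.{u}.ι

end FibrantSemiSSet

/-! The proof rests on one combinatorial fact, `pushoutProductLifting_horn`: fibrations lift against
the pushout product of a horn inclusion Λⁿ_k → Δⁿ with any monomorphism A → B. A simplex of Δⁿ ⊗ B
is a strictly increasing chain in a grid [n] × [b], together with an element of B_b. Fix a column k'
= k ± 1. A chain outside the union of Λⁿ_k ⊗ B and Δⁿ ⊗ A meets column k'; let (k', y) be its vertex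
there that is closest to column k. The chains outside the union then come in pairs: those containing
(k, y), and the same chains with (k, y) deleted. `Prism.isPairing` orders the pairs by a
well-founded rank so that each one is attached along a single horn, and `IsPairing.exists_lift`
turns such a pairing into a lift.

By the adjunction between - ⊗ K and mapping spaces, mapping spaces into fibrant objects are fibrant,
and homotopies are their edges. Constant homotopies are missing, since there are no degeneracies.
They are replaced by idempotent loops: horn filling yields at every vertex a loop e that is all
three sides of a triangle (`IsFibrant.exists_idempotent`). Hence homotopy is a congruence, the weak
equivalences are the maps inverted by the quotient category, and 2-out-of-6 follows from the same
property of isomorphisms.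

The trivial fibrations between fibrant objects are exactly the maps with the right lifting property
against all monomorphisms (`rlp_monomorphisms_of_homotopyEquivalence`,
`homotopyEquivalences_of_rlp_monomorphisms`), a class stable under pullback. Factorizations come
from the mapping path space (`exists_factorization`). -/

namespace SemiSSet

/-! ### Faces of the semisimplex -/

/-- The `i`-th coface map `[n] ↪ [n + 1]`. -/
def coface {n : ℕ} (i : Fin (n + 2)) : (⦋n⦌ₛ : SemiSimplexCategory) ⟶ ⦋n + 1⦌ₛ :=
  SemiSimplexCategory.homEquiv.symm (Fin.succAboveOrderEmb i)

@[simp]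
lemma homEquiv_coface {n : ℕ} (i : Fin (n + 2)) :
    SemiSimplexCategory.homEquiv (coface i) = Fin.succAboveOrderEmb i :=
  Equiv.apply_symm_apply _ _

lemma toSimplexCategory_map_coface {n : ℕ} (i : Fin (n + 2)) :
    SemiSimplexCategory.toSimplexCategory.map (coface i) = SimplexCategory.δ i := by
  ext x : 3
  rfl

lemma hom_ext_of_range {l m : SemiSimplexCategory} {f g : l ⟶ m}
    (h : Set.range (SemiSimplexCategory.homEquiv f) = Set.range (SemiSimplexCategory.homEquiv g)) :
    f = g := by
  apply SemiSimplexCategory.hom_ext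
  apply DFunLike.coe_injective
  exact (StrictMono.range_inj (SemiSimplexCategory.homEquiv f).strictMono
    (SemiSimplexCategory.homEquiv g).strictMono).1 h

lemma exists_factor_of_range_subset {l m n : SemiSimplexCategory} (f : l ⟶ n) (g : m ⟶ n)
    (h : Set.range (SemiSimplexCategory.homEquiv f) ⊆ Set.range (SemiSimplexCategory.homEquiv g)) :
    ∃ a : l ⟶ m, a ≫ g = f := by
  choose a ha using fun x => h ⟨x, rfl⟩
  have hmono : StrictMono a := fun x y hxy => by
    rw [← (SemiSimplexCategory.homEquiv g).lt_iff_lt, ha, ha]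
    exact (SemiSimplexCategory.homEquiv f).strictMono hxy
  refine ⟨SemiSimplexCategory.homEquiv.symm (OrderEmbedding.ofStrictMono a hmono), ?_⟩
  ext x : 2
  rw [SemiSimplexCategory.homEquiv_comp, RelEmbedding.trans_apply, Equiv.apply_symm_apply]
  exact ha x

lemma range_coface {n : ℕ} (i : Fin (n + 2)) :
    Set.range (SemiSimplexCategory.homEquiv (coface i)) = {i}ᶜ := by
  rw [homEquiv_coface]
  exact Fin.range_succAbove i

/-- A simplex of the horn lies in a face other than the `k`-th. -/
lemma MemHorn.exists_coface {n : ℕ} {k : Fin (n + 2)} {l : SemiSimplexCategory}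
    {f : l ⟶ ⦋n + 1⦌ₛ} (hf : MemHorn k f) :
    ∃ j ≠ k, ∃ g : l ⟶ ⦋n⦌ₛ, g ≫ coface j = f := by
  obtain ⟨j, hj⟩ := (Set.ne_univ_iff_exists_notMem _).1 hf
  simp only [Set.mem_union, Set.mem_singleton_iff, not_or] at hj
  refine ⟨j, hj.2, exists_factor_of_range_subset _ _ ?_⟩
  rw [range_coface]
  rintro _ ⟨x, rfl⟩ (rfl : _ = j)
  exact hj.1 ⟨x, rfl⟩

lemma memHorn_coface {n : ℕ} {k j : Fin (n + 2)} (h : j ≠ k) : MemHorn k (coface j) := by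
  intro e
  have : j ∈ Set.range (SemiSimplexCategory.homEquiv (coface j)) ∪ {k} := by rw [e]; trivial
  rw [range_coface] at this
  simp [h] at this

lemma not_memHorn_coface {n : ℕ} (k : Fin (n + 2)) : ¬ MemHorn k (coface k) := by
  rw [MemHorn, range_coface, not_not, Set.compl_union_self]

lemma not_memHorn_id {n : ℕ} (k : Fin (n + 2)) : ¬ MemHorn k (𝟙 ⦋n + 1⦌ₛ) := by
  rw [MemHorn, not_not]
  refine Set.eq_univ_of_forall fun x => Or.inl ⟨x, rfl⟩

lemma exists_factor_coface_of_not_memHorn {n : ℕ} {k : Fin (n + 2)} {l : SemiSimplexCategory}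
    {f : l ⟶ ⦋n + 1⦌ₛ} (hf : ¬ MemHorn k f) : ∃ g : ⦋n⦌ₛ ⟶ l, g ≫ f = coface k := by
  rw [MemHorn, not_not] at hf
  apply exists_factor_of_range_subset
  rw [range_coface]
  intro x hx
  have : x ∈ Set.range (SemiSimplexCategory.homEquiv f) ∪ {k} := by rw [hf]; trivial
  exact this.resolve_right hx

/-- The image contains every vertex other than k, so the only simplices missing from the horn are
the top one and its k-th face. -/
lemma range_of_not_memHorn {n : ℕ} {k : Fin (n + 2)} {l : SemiSimplexCategory}
    {f : l ⟶ ⦋n + 1⦌ₛ} (hf : ¬ MemHorn k f) :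
    (l.len = n + 1 ∧ Set.range (SemiSimplexCategory.homEquiv f) = Set.univ) ∨
    (l.len = n ∧ Set.range (SemiSimplexCategory.homEquiv f) = {k}ᶜ) := by
  rw [MemHorn, not_not] at hf
  have hc : (Set.range (SemiSimplexCategory.homEquiv f)).ncard = l.len + 1 := by
    rw [← Set.image_univ, Set.ncard_image_of_injective _ (SemiSimplexCategory.homEquiv f).injective,
      Set.ncard_univ, Nat.card_fin]
  by_cases hk : k ∈ Set.range (SemiSimplexCategory.homEquiv f)
  · left
    have h : Set.range (SemiSimplexCategory.homEquiv f) = Set.univ := by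
      rw [← hf, Set.union_eq_left.2 (Set.singleton_subset_iff.2 hk)]
    refine ⟨?_, h⟩
    rw [h, Set.ncard_univ, Nat.card_fin] at hc
    simpa using hc.symm
  · right
    have h : Set.range (SemiSimplexCategory.homEquiv f) = {k}ᶜ := by
      ext x
      have hx : x ∈ Set.range (SemiSimplexCategory.homEquiv f) ∪ {k} := by rw [hf]; trivial
      refine ⟨fun h h' => hk (h' ▸ h), fun h => hx.resolve_right h⟩
    refine ⟨?_, h⟩
    rw [h, Set.ncard_compl, Nat.card_fin, Set.ncard_singleton] at hc
    simp only at hc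
    omega

lemma eq_of_not_memHorn {n : ℕ} {k : Fin (n + 2)} {l : SemiSimplexCategory}
    {f g : l ⟶ ⦋n + 1⦌ₛ} (hf : ¬ MemHorn k f) (hg : ¬ MemHorn k g) : f = g := by
  apply hom_ext_of_range
  obtain ⟨h₁, h₂⟩ | ⟨h₁, h₂⟩ := range_of_not_memHorn hf <;>
  obtain ⟨h₃, h₄⟩ | ⟨h₃, h₄⟩ := range_of_not_memHorn hg <;>
  first | omega | exact h₂.trans h₄.symm

/-! ### Partial lifts -/

section PartialLift

variable {T X Y : SemiSSet.{u}}

/-- A partial lift of `t : T ⟶ Y` along `p : X ⟶ Y`, given by its graph. -/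
structure IsPartialLift (t : T ⟶ Y) (p : X ⟶ Y) (R : ∀ n, T.obj n → X.obj n → Prop) : Prop where
  map : ∀ {n m} (f : n ⟶ m) {z x}, R n z x → R m (T.map f z) (X.map f x)
  unique : ∀ {n z x x'}, R n z x → R n z x' → x = x'
  comm : ∀ {n z x}, R n z x → p.app n x = t.app n z

variable {t : T ⟶ Y} {p : X ⟶ Y} {R : ∀ n, T.obj n → X.obj n → Prop}

lemma IsPartialLift.exists_lift (hR : IsPartialLift t p R) (h : ∀ n z, ∃ x, R n z x) :
    ∃ l : T ⟶ X, l ≫ p = t ∧ ∀ n z, R n z (l.app n z) := by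
  choose l hl using h
  refine ⟨{ app n := ↾(l n), naturality n m f := ?_ }, ?_, hl⟩
  · ext z
    exact hR.unique (hl _ _) (hR.map f (hl _ _))
  · ext n z
    exact hR.comm (hl n z)

/-- A partial lift defined on a horn of the simplex `s` restricts to a map from the horn, and so
extends over the whole simplex if `p` is a fibration. -/
lemma IsPartialLift.exists_filler (hR : IsPartialLift t p R) (hp : fibrations p) {m : ℕ}
    (k : Fin (m + 2)) (s : T.obj (op ⦋m + 1⦌ₛ))
    (hs : ∀ {l} (f : l ⟶ ⦋m + 1⦌ₛ), MemHorn k f → ∃ x, R _ (T.map f.op s) x) :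
    ∃ e : X.obj (op ⦋m + 1⦌ₛ), p.app _ e = t.app _ s ∧
      ∀ {l} (f : l ⟶ ⦋m + 1⦌ₛ), MemHorn k f → R _ (T.map f.op s) (X.map f.op e) := by
  choose g hg using @hs
  have hcongr : ∀ {l} {f f' : l ⟶ ⦋m + 1⦌ₛ} (h : f = f') (hf : MemHorn k f), g f hf =
      g f' (h ▸ hf) := by
    rintro l f _ rfl hf
    rfl
  let α : (horn.{u} (m + 1) k).toFunctor ⟶ X :=
    { app n := ↾fun f => g (ULift.down f.1 : n.unop ⟶ _) f.2
      naturality n n' a := by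
        ext f
        have e := hR.map a (hg (ULift.down f.1 : n.unop ⟶ _) f.2)
        rw [← Functor.map_comp_apply, show (ULift.down f.1 : n.unop ⟶ _).op ≫ a =
          (a.unop ≫ (ULift.down f.1 : n.unop ⟶ _)).op from rfl] at e
        have h' := hR.unique (hg (a.unop ≫ (ULift.down f.1 : n.unop ⟶ _))
          (MemHorn.precomp _ f.2)) e
        refine Eq.trans (hcongr ?_ ((horn.{u} (m + 1) k).map a f.2)) h'
        simp }
  let β : simplex.{u} (m + 1) ⟶ Y := uliftYonedaEquiv.symm (t.app _ s)
  have sq : CommSq α (horn.{u} (m + 1) k).ι p β := ⟨by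
    ext n f
    refine (hR.comm (hg (ULift.down f.1 : n.unop ⟶ _) f.2)).trans ?_
    exact NatTrans.naturality_apply t (Quiver.Hom.op (ULift.down f.1 : n.unop ⟶ _)) s⟩
  have : HasLiftingProperty (horn.{u} (m + 1) k).ι p :=
    hp _ (by
      rw [hornInclusions, MorphismProperty.iSup_iff]
      exact ⟨m, ⟨k⟩⟩)
  refine ⟨uliftYonedaEquiv sq.lift, ?_, ?_⟩
  · have := sq.fac_right
    rw [← uliftYonedaEquiv_comp, this]
    exact uliftYonedaEquiv.apply_symm_apply _
  · intro l f hf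
    have e := ConcreteCategory.congr_hom (NatTrans.congr_app sq.fac_left (op l)) ⟨ULift.up f, hf⟩
    have e' : X.map f.op (uliftYonedaEquiv sq.lift) = g f hf := by
      refine Eq.trans ?_ e
      change _ = sq.lift.app (op l) (ULift.up f)
      rw [uliftYonedaEquiv_apply]
      refine (NatTrans.naturality_apply sq.lift f.op _).symm.trans ?_
      simp
    rw [e']
    exact hg f hf

/-- The partial lift obtained by adding all faces of a filler. -/
lemma IsPartialLift.adjoin (hR : IsPartialLift t p R) {m : ℕ}
    (k : Fin (m + 2)) (s : T.obj (op ⦋m + 1⦌ₛ)) (e : X.obj (op ⦋m + 1⦌ₛ))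
    (hk : ¬ ∃ x, R _ (T.map (coface k).op s) x) (he : p.app _ e = t.app _ s)
    (hs : ∀ {l} (f : l ⟶ ⦋m + 1⦌ₛ), MemHorn k f → R _ (T.map f.op s) (X.map f.op e)) :
    IsPartialLift t p
      (fun n z x => R n z x ∨ ∃ f : op ⦋m + 1⦌ₛ ⟶ n, z = T.map f s ∧ x = X.map f e) := by
  -- A face of s outside the horn has the k-th face of s among its own faces, so R cannot be defined
  -- on it.
  have key : ∀ {l} (f : op ⦋m + 1⦌ₛ ⟶ l), ¬ MemHorn k f.unop → ∀ x, ¬ R _ (T.map f s) x := by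
    intro l f hf x hx
    obtain ⟨g, hg⟩ := exists_factor_coface_of_not_memHorn hf
    refine hk ⟨X.map g.op x, ?_⟩
    rw [← hg]
    simpa using hR.map g.op hx
  have hs' : ∀ {l} (f : op ⦋m + 1⦌ₛ ⟶ l), MemHorn k f.unop → R l (T.map f s) (X.map f e) :=
    fun f hf => hs f.unop hf
  refine ⟨?_, ?_, ?_⟩
  · rintro n n' a z x (h | ⟨f, rfl, rfl⟩)
    · exact Or.inl (hR.map a h)
    · exact Or.inr ⟨f ≫ a, by simp, by simp⟩
  · rintro n z x x' (h | ⟨f, rfl, rfl⟩) (h' | ⟨f', e', rfl⟩)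
    · exact hR.unique h h'
    · subst e'
      by_cases hf : MemHorn k f'.unop
      · exact hR.unique h (hs' _ hf)
      · exact absurd h (key _ hf _)
    · by_cases hf : MemHorn k f.unop
      · exact hR.unique (hs' _ hf) h'
      · exact absurd h' (key _ hf _)
    · by_cases hf : MemHorn k f.unop
      · by_cases hf' : MemHorn k f'.unop
        · refine hR.unique (hs' _ hf) ?_
          have := hs' _ hf'
          rwa [e']
        · have := hs' _ hf
          rw [e'] at this
          exact absurd this (key _ hf' _)
      · by_cases hf' : MemHorn k f'.unop
        · have := hs' _ hf'
          rw [← e'] at this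
          exact absurd this (key _ hf _)
        · rw [Quiver.Hom.unop_inj (eq_of_not_memHorn hf hf')]
  · rintro n z x (h | ⟨f, rfl, rfl⟩)
    · exact hR.comm h
    · rw [NatTrans.naturality_apply, NatTrans.naturality_apply, he]

lemma isPartialLift_sSup {c : Set (∀ n, T.obj n → X.obj n → Prop)} (hc : IsChain (· ≤ ·) c)
    (h : ∀ R ∈ c, IsPartialLift t p R) :
    IsPartialLift t p (fun n z x => ∃ R ∈ c, R n z x) := by
  refine ⟨?_, ?_, ?_⟩
  · rintro n m f z x ⟨R, hR, hx⟩
    exact ⟨R, hR, (h R hR).map f hx⟩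
  · rintro n z x x' ⟨R, hR, hx⟩ ⟨R', hR', hx'⟩
    obtain hle | hle := hc.total hR hR'
    · exact (h R' hR').unique (hle _ _ _ hx) hx'
    · exact (h R hR).unique hx (hle _ _ _ hx')
  · rintro n z x ⟨R, hR, hx⟩
    exact (h R hR).comm hx

/-- A pairing of the simplices of `T` outside the subset `S`: such a simplex is either `σ` or `τ`
for a unique pair consisting of a simplex `σ` and its `k`-th face `τ`, and the other faces of `σ`
belong to `S` or to pairs of smaller rank. -/
structure IsPairing {α : Type*} [LT α] (S : ∀ n : ℕ, T.obj (op ⦋n⦌ₛ) → Prop)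
    (Pair : ∀ {m : ℕ}, T.obj (op ⦋m⦌ₛ) → T.obj (op ⦋m + 1⦌ₛ) → Fin (m + 2) → α → Prop) :
    Prop where
  face : ∀ {m} {τ : T.obj (op ⦋m⦌ₛ)} {σ k r}, Pair τ σ k r → T.map (coface k).op σ = τ
  notMem : ∀ {m} {τ : T.obj (op ⦋m⦌ₛ)} {σ k r}, Pair τ σ k r → ¬ S m τ
  unique : ∀ {m} {τ : T.obj (op ⦋m⦌ₛ)} {σ k r σ' k' r'}, Pair τ σ k r → Pair τ σ' k' r' → σ = σ'
  disjoint : ∀ {m} {ρ : T.obj (op ⦋m⦌ₛ)} {τ σ k r k' r'}, Pair τ σ k r → ¬ Pair ρ τ k' r'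
  cover : ∀ (D : ∀ n : ℕ, T.obj (op ⦋n⦌ₛ) → Prop), (∀ n z, S n z → D n z) →
    (∀ {m} {τ : T.obj (op ⦋m⦌ₛ)} {σ k r}, Pair τ σ k r → D m τ ∧ D (m + 1) σ) → ∀ n z, D n z
  otherFace : ∀ {m} {τ : T.obj (op ⦋m⦌ₛ)} {σ k r}, Pair τ σ k r → ∀ j ≠ k,
    ∀ (D : ∀ n : ℕ, T.obj (op ⦋n⦌ₛ) → Prop), (∀ n z, S n z → D n z) →
    (∀ {m'} {τ' : T.obj (op ⦋m'⦌ₛ)} {σ' k' r'}, r' < r → Pair τ' σ' k' r' →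
      D m' τ' ∧ D (m' + 1) σ') → D m (T.map (coface j).op σ)

/-- Zorn's lemma is applied to the partial lifts that contain σ as soon as they contain its partner
τ. For a maximal one, induction on the rank shows that every σ is reached: all faces of σ other than
τ are already covered, so if σ were missing then so would be τ, and filling this horn would give a
proper extension. -/
theorem IsPairing.exists_lift {α : Type*} [Preorder α] [WellFoundedLT α]
    {S : ∀ n : ℕ, T.obj (op ⦋n⦌ₛ) → Prop}
    {Pair : ∀ {m : ℕ}, T.obj (op ⦋m⦌ₛ) → T.obj (op ⦋m + 1⦌ₛ) → Fin (m + 2) → α → Prop}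
    (hP : IsPairing S Pair) (hp : fibrations p) (hR : IsPartialLift t p R)
    (hS : ∀ n z, S n z ↔ ∃ x, R (op ⦋n⦌ₛ) z x) :
    ∃ l : T ⟶ X, l ≫ p = t ∧ ∀ n z x, R n z x → l.app n z = x := by
  let C : Set (∀ n, T.obj n → X.obj n → Prop) := {Q | IsPartialLift t p Q ∧
    ∀ {m} {τ : T.obj (op ⦋m⦌ₛ)} {σ k r}, Pair τ σ k r → (∃ x, Q _ τ x) → ∃ x, Q _ σ x}
  have hRC : R ∈ C := ⟨hR, fun h hx => absurd ((hS _ _).2 hx) (hP.notMem h)⟩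
  obtain ⟨Q, hRQ, hQ⟩ := zorn_le_nonempty₀ C (by
    intro c hc hchain Q₀ hQ₀
    refine ⟨fun n z x => ∃ Q ∈ c, Q n z x,
      ⟨isPartialLift_sSup hchain fun Q hQ => (hc hQ).1, ?_⟩, ?_⟩
    · rintro m τ σ k r h ⟨x, Q, hQ, hx⟩
      obtain ⟨y, hy⟩ := (hc hQ).2 h ⟨x, hx⟩
      exact ⟨y, Q, hQ, hy⟩
    · intro Q hQ n z x hx
      exact ⟨Q, hQ, hx⟩) R hRC
  obtain ⟨⟨hQ₁, hQ₂⟩, hmax⟩ := hQ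
  have hSQ : ∀ n z, S n z → ∃ x, Q (op ⦋n⦌ₛ) z x := fun n z h => by
    obtain ⟨x, hx⟩ := (hS n z).1 h
    exact ⟨x, hRQ _ _ _ hx⟩
  have main : ∀ r, ∀ {m} {τ : T.obj (op ⦋m⦌ₛ)} {σ k}, Pair τ σ k r → ∃ x, Q _ σ x := by
    intro r
    induction r using WellFoundedLT.induction with
    | ind r ih =>
    intro m τ σ k hpair
    by_contra hσ
    have hτ : ¬ ∃ x, Q _ (T.map (coface k).op σ) x := by
      rw [hP.face hpair]
      exact fun h => hσ (hQ₂ hpair h)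
    have hfaces : ∀ {l} (f : l ⟶ ⦋m + 1⦌ₛ), MemHorn k f → ∃ x, Q _ (T.map f.op σ) x := by
      intro l f hf
      obtain ⟨j, hj, g, rfl⟩ := hf.exists_coface
      obtain ⟨x, hx⟩ := hP.otherFace hpair j hj (fun n z => ∃ x, Q (op ⦋n⦌ₛ) z x) hSQ
        (fun {m' τ' σ' k' r'} hr h => by
          obtain ⟨y, hy⟩ := ih r' hr h
          refine ⟨⟨X.map (coface k').op y, ?_⟩, y, hy⟩
          rw [← hP.face h]
          exact hQ₁.map _ hy)
      exact ⟨X.map g.op x, by simpa using hQ₁.map g.op hx⟩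
    obtain ⟨e, he, hes⟩ := hQ₁.exists_filler hp k σ hfaces
    have hadj := hQ₁.adjoin k σ e hτ he hes
    have := hmax (y := _) ⟨hadj, ?_⟩ (fun n z x h => Or.inl h)
    · exact hσ ⟨e, this _ _ _ (Or.inr ⟨𝟙 _, by simp, by simp⟩)⟩
    -- The extension must again be closed under passing from τ' to σ'. The new simplices are only σ
    -- and τ: disjointness prevents σ from being the smaller member of a pair, and by uniqueness the
    -- partner of τ is σ.
    · rintro m' τ' σ' k' r' h ⟨x, hx | ⟨f, hf, rfl⟩⟩
      · obtain ⟨y, hy⟩ := hQ₂ h ⟨x, hx⟩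
        exact ⟨y, Or.inl hy⟩
      · by_cases hfk : MemHorn k f.unop
        · have hx := hes _ hfk
          rw [show f.unop.op = f from rfl, ← hf] at hx
          obtain ⟨y, hy⟩ := hQ₂ h ⟨_, hx⟩
          exact ⟨y, Or.inl hy⟩
        · have hm : m' = m + 1 ∨ m' = m :=
            (range_of_not_memHorn hfk).imp And.left And.left
          obtain rfl | rfl := hm
          · have : f = 𝟙 _ := Quiver.Hom.unop_inj (eq_of_not_memHorn hfk (not_memHorn_id k))
            subst this
            rw [CategoryTheory.Functor.map_id, ConcreteCategory.id_apply] at hf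
            subst hf
            exact absurd hpair (hP.disjoint h)
          · have : f = (coface k).op :=
              Quiver.Hom.unop_inj (eq_of_not_memHorn hfk (not_memHorn_coface k))
            subst this
            rw [hP.face hpair] at hf
            subst hf
            rw [hP.unique h hpair]
            exact ⟨e, Or.inr ⟨𝟙 _, by simp, by simp⟩⟩
  have htotal : ∀ n z, ∃ x, Q n z x := by
    rintro ⟨n⟩ z
    exact hP.cover (fun n z => ∃ x, Q (op ⦋n⦌ₛ) z x) hSQ (fun {m τ σ k r} h => by
      obtain ⟨y, hy⟩ := main r h
      refine ⟨⟨X.map (coface k).op y, ?_⟩, y, hy⟩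
      rw [← hP.face h]
      exact hQ₁.map _ hy) n.len z
  obtain ⟨l, hl, hlQ⟩ := hQ₁.exists_lift htotal
  exact ⟨l, hl, fun n z x hx => hQ₁.unique (hlQ n z) (hRQ _ _ _ hx)⟩

end PartialLift

open SemiSimplexCategory (toSimplexCategory)

/-! ### Elements of the geometric product -/

/-- Maps out of [0] are vertices, so joint monicity is joint injectivity on vertices. This is what
makes a simplex of a geometric product a strictly increasing chain in a grid. -/
lemma jointlyMono_iff {S S' S'' : SimplexCategory} (p : S ⟶ S') (q : S ⟶ S'') :
    JointlyMono p q ↔ ∀ a b, p.toOrderHom a = p.toOrderHom b →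
      q.toOrderHom a = q.toOrderHom b → a = b := by
  constructor
  · intro h a b hp hq
    have := h (SimplexCategory.const ⦋0⦌ S a) (SimplexCategory.const ⦋0⦌ S b)
      (by ext x : 3; exact hp) (by ext x : 3; exact hq)
    exact SimplexCategory.congr_toOrderHom_apply this 0
  · intro h T s t hp hq
    ext x : 3
    exact h _ _ (SimplexCategory.congr_toOrderHom_apply hp x)
      (SimplexCategory.congr_toOrderHom_apply hq x)

/-- An order embedding between ordinals of equal size is the identity. Values are compared as
natural numbers because the two objects need not be syntactically equal. -/
lemma val_homEquiv_of_len_eq {c d : SemiSimplexCategory} (f : c ⟶ d) (h : c.len = d.len)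
    (x : Fin (c.len + 1)) : (SemiSimplexCategory.homEquiv f x).val = x.val := by
  obtain ⟨c⟩ := c
  obtain ⟨d⟩ := d
  obtain rfl : c = d := h
  have := SimplexCategory.eq_id_of_mono (toSimplexCategory.map f)
  exact congrArg Fin.val (SimplexCategory.congr_toOrderHom_apply this x)

namespace FreeSimplex

variable {A B : SemiSSet.{u}} {S S' : SimplexCategory}

lemma map_injective (i : A ⟶ B) [Mono i] : Function.Injective (FreeSimplex.map (S := S) i) := by
  rintro ⟨c, p, hp, x⟩ ⟨c', p', hp', x'⟩ h
  simp only [map, mk.injEq] at h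
  obtain ⟨rfl, h₁, h₂⟩ := h
  obtain rfl := eq_of_heq h₁
  have : Function.Injective (i.app (op c)) := (mono_iff_injective _).1 inferInstance
  rw [this (eq_of_heq h₂)]

lemma restrict_of_epi (z : FreeSimplex A S) (f : S' ⟶ S) [Epi f] :
    z.restrict f = ⟨z.cod, f ≫ z.proj, @epi_comp _ _ _ _ _ f _ z.proj z.epi, z.elt⟩ := by
  rw [restrict_eq f z z.cod (f ≫ z.proj) (@epi_comp _ _ _ _ _ f _ z.proj z.epi) (𝟙 _) (by simp)]
  simp

lemma restrict_eq_self (z : FreeSimplex A S) (f : S ⟶ S) (h : f ≫ z.proj = z.proj) :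
    z.restrict f = z := by
  rw [restrict_eq f z z.cod z.proj z.epi (𝟙 _) (by simp [h])]
  simp

/-- The value of the epimorphism of a simplex at a vertex, as a natural number. -/
def val (z : FreeSimplex A S) (a : Fin (S.len + 1)) : ℕ := (z.proj.toOrderHom a).val

lemma val_le (z : FreeSimplex A S) (a : Fin (S.len + 1)) : z.val a ≤ z.cod.len :=
  Nat.lt_succ_iff.1 (z.proj.toOrderHom a).isLt

lemma val_mono (z : FreeSimplex A S) {a b : Fin (S.len + 1)} (h : a ≤ b) : z.val a ≤ z.val b :=
  z.proj.toOrderHom.monotone h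

lemma val_restrict_of_epi (z : FreeSimplex A S) (f : S' ⟶ S) [Epi f] (a : Fin (S'.len + 1)) :
    (z.restrict f).val a = z.val (f.toOrderHom a) := by
  rw [restrict_of_epi]
  rfl

lemma cod_restrict_of_epi (z : FreeSimplex A S) (f : S' ⟶ S) [Epi f] :
    (z.restrict f).cod = z.cod := by
  rw [restrict_of_epi]

lemma restrict_fac_apply (z : FreeSimplex A S) (f : S' ⟶ S) :
    ∃ i : (z.restrict f).cod ⟶ z.cod, ∀ a, SemiSimplexCategory.homEquiv i
      ((z.restrict f).proj.toOrderHom a) = z.proj.toOrderHom (f.toOrderHom a) := by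
  obtain ⟨i, hi, -⟩ := restrict_fac f z
  exact ⟨i, fun a => SimplexCategory.congr_toOrderHom_apply hi a⟩

lemma len_cod_restrict_le (z : FreeSimplex A S) (f : S' ⟶ S) :
    (z.restrict f).cod.len ≤ z.cod.len := by
  obtain ⟨i, -⟩ := z.restrict_fac_apply f
  exact SimplexCategory.len_le_of_mono (toSimplexCategory.map i)

lemma val_restrict_of_len_eq (z : FreeSimplex A S) (f : S' ⟶ S)
    (h : (z.restrict f).cod.len = z.cod.len) (a : Fin (S'.len + 1)) :
    (z.restrict f).val a = z.val (f.toOrderHom a) := by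
  obtain ⟨i, hi⟩ := z.restrict_fac_apply f
  rw [val, val, ← hi]
  exact (val_homEquiv_of_len_eq i h _).symm

/-- The map to `[n]` corresponding to a simplex of the free simplicial set on `Δⁿ`. -/
def toHom {n : ℕ} (z : FreeSimplex (simplex.{u} n) S) : S ⟶ toSimplexCategory.obj ⦋n⦌ₛ :=
  z.proj ≫ toSimplexCategory.map (ULift.down z.elt : z.cod ⟶ ⦋n⦌ₛ)

/-- The simplex of the free simplicial set on `Δⁿ` corresponding to a map to `[n]`. -/
noncomputable def ofHom {n : ℕ} (φ : S ⟶ toSimplexCategory.obj ⦋n⦌ₛ) : FreeSimplex (simplex.{u} n) S :=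
  ⟨factObj φ, factProj φ, inferInstance, ULift.up (factIncl φ)⟩

@[simp]
lemma toHom_ofHom {n : ℕ} (φ : S ⟶ toSimplexCategory.obj ⦋n⦌ₛ) : toHom (ofHom.{u} φ) = φ :=
  fact_fac φ

/-- By uniqueness of epi-mono factorizations, the free simplicial set on Δⁿ is the full simplicial
n-simplex: its S-simplices are arbitrary maps S ⟶ [n]. -/
lemma ofHom_toHom {n : ℕ} (z : FreeSimplex (simplex.{u} n) S) : ofHom z.toHom = z := by
  obtain ⟨d, p, hp, ⟨i⟩⟩ := z
  have key : ∀ φ : S ⟶ toSimplexCategory.obj ⦋n⦌ₛ, p ≫ toSimplexCategory.map i = φ →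
      ofHom.{u} φ = ⟨d, p, hp, ULift.up i⟩ := by
    intro φ hφ
    obtain ⟨h, h₁, h₂⟩ := fact_unique φ p hp i hφ
    subst h
    simp only [eqToHom_refl, Category.comp_id, Category.id_comp] at h₁ h₂
    subst h₁ h₂
    rfl
  exact key _ rfl

lemma toHom_injective {n : ℕ} :
    Function.Injective (toHom : FreeSimplex (simplex.{u} n) S → (S ⟶ toSimplexCategory.obj ⦋n⦌ₛ)) := fun z z' h => by
  rw [← ofHom_toHom z, h, ofHom_toHom]

lemma toHom_restrict {n : ℕ} (z : FreeSimplex (simplex.{u} n) S) (f : S' ⟶ S) :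
    (z.restrict f).toHom = f ≫ z.toHom := by
  obtain ⟨i, hi, hi'⟩ := restrict_fac f z
  have e : (ULift.down (z.restrict f).elt : _ ⟶ ⦋n⦌ₛ) = i ≫ ULift.down z.elt := by
    rw [hi']
    simp
  rw [toHom, e, Functor.map_comp, reassoc_of% hi]
  rfl

lemma jointlyMono_toHom_iff {n : ℕ} (z : FreeSimplex (simplex.{u} n) S) (q : S ⟶ S') :
    JointlyMono z.toHom q ↔ JointlyMono z.proj q := by
  constructor
  · intro h T s t hp hq
    exact h s t (by rw [toHom, reassoc_of% hp]) hq
  · intro h T s t hp hq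
    refine h s t ?_ hq
    rw [toHom, ← Category.assoc, ← Category.assoc] at hp
    exact (cancel_mono _).1 hp

end FreeSimplex

/-! ### Lifting against pushout products -/

section PushoutProduct

variable {A B K L X Y : SemiSSet.{u}}

lemma geomProd.ext {n} {z z' : (geomProd A B).obj n} (h₁ : z.1.1 = z'.1.1)
    (h₂ : z.1.2 = z'.1.2) : z = z' :=
  Subtype.ext (Prod.ext h₁ h₂)

lemma geomProd.snd_map {n m} (f : n ⟶ m) (z : (geomProd A B).obj n) :
    ((geomProd A B).map f z).1.2 = z.1.2.restrict (toSimplexCategory.map f.unop) := rfl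

lemma geomProdMap_comp {A' A'' B' B'' : SemiSSet.{u}} (f : A ⟶ A') (f' : A' ⟶ A'')
    (g : B ⟶ B') (g' : B' ⟶ B'') :
    geomProdMap (f ≫ f') (g ≫ g') = geomProdMap f g ≫ geomProdMap f' g' := rfl

instance mono_geomProdMap (f : A ⟶ K) (g : B ⟶ L) [Mono f] [Mono g] : Mono (geomProdMap f g) := by
  have : ∀ n, Mono ((geomProdMap f g).app n) := fun n => by
    rw [mono_iff_injective]
    intro z z' h
    exact geomProd.ext (FreeSimplex.map_injective f (congrArg (fun z => z.1.1) h))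
      (FreeSimplex.map_injective g (congrArg (fun z => z.1.2) h))
  exact NatTrans.mono_of_mono_app _

/-- The map `p` has the right lifting property against the pushout product of `j : K ⟶ L` and
`i : A ⟶ B`. -/
def PushoutProductLifting (j : K ⟶ L) (i : A ⟶ B) (p : X ⟶ Y) : Prop :=
  ∀ (f : geomProd K B ⟶ X) (g : geomProd L A ⟶ X) (t : geomProd L B ⟶ Y),
    geomProdMap (𝟙 K) i ≫ f = geomProdMap j (𝟙 A) ≫ g → f ≫ p = geomProdMap j (𝟙 B) ≫ t →
    g ≫ p = geomProdMap (𝟙 L) i ≫ t →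
    ∃ l : geomProd L B ⟶ X, geomProdMap j (𝟙 B) ≫ l = f ∧ geomProdMap (𝟙 L) i ≫ l = g ∧ l ≫ p = t

/-- The graph of the map defined on the union of `K ⊗ B` and `L ⊗ A`. -/
def pushoutProductGraph (j : K ⟶ L) (i : A ⟶ B) (f : geomProd K B ⟶ X) (g : geomProd L A ⟶ X) :
    ∀ n, (geomProd L B).obj n → X.obj n → Prop := fun n z x =>
  (∃ w, (geomProdMap j (𝟙 B)).app n w = z ∧ f.app n w = x) ∨
    (∃ w, (geomProdMap (𝟙 L) i).app n w = z ∧ g.app n w = x)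

lemma isPartialLift_pushoutProductGraph (j : K ⟶ L) [Mono j] (i : A ⟶ B) [Mono i]
    (f : geomProd K B ⟶ X) (g : geomProd L A ⟶ X) (t : geomProd L B ⟶ Y) (p : X ⟶ Y)
    (hfg : geomProdMap (𝟙 K) i ≫ f = geomProdMap j (𝟙 A) ≫ g)
    (hf : f ≫ p = geomProdMap j (𝟙 B) ≫ t) (hg : g ≫ p = geomProdMap (𝟙 L) i ≫ t) :
    IsPartialLift t p (pushoutProductGraph j i f g) := by
  have hinj : ∀ {A' B' : SemiSSet.{u}} (φ : A' ⟶ B') [Mono φ] n, Function.Injective (φ.app n) :=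
    fun φ _ n => (mono_iff_injective _).1 inferInstance
  -- The two pieces overlap exactly in K ⊗ A: a common simplex has its first component from K and
  -- its second from A, and joint monicity involves only the projections.
  have key : ∀ n w w', (geomProdMap j (𝟙 B)).app n w = (geomProdMap (𝟙 L) i).app n w' →
      f.app n w = g.app n w' := by
    intro n w w' h
    have h₁ : w.1.1.map j = w'.1.1 := congrArg (fun z => z.1.1) h
    have h₂ : w.1.2 = w'.1.2.map i := congrArg (fun z => z.1.2) h
    have hm : JointlyMono w.1.1.proj w'.1.2.proj := by
      have := w.2
      rw [h₂] at this
      exact this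
    let v : (geomProd K A).obj n := ⟨(w.1.1, w'.1.2), hm⟩
    have e₁ : (geomProdMap (𝟙 K) i).app n v = w := geomProd.ext rfl h₂.symm
    have e₂ : (geomProdMap j (𝟙 A)).app n v = w' := geomProd.ext h₁ rfl
    rw [← e₁, ← e₂]
    exact ConcreteCategory.congr_hom (NatTrans.congr_app hfg n) v
  refine ⟨?_, ?_, ?_⟩
  · rintro n m a z x (⟨w, rfl, rfl⟩ | ⟨w, rfl, rfl⟩)
    · exact Or.inl ⟨(geomProd K B).map a w,
        NatTrans.naturality_apply (geomProdMap j (𝟙 B)) a w, NatTrans.naturality_apply f a w⟩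
    · exact Or.inr ⟨(geomProd L A).map a w,
        NatTrans.naturality_apply (geomProdMap (𝟙 L) i) a w, NatTrans.naturality_apply g a w⟩
  · rintro n z x x' (⟨w, rfl, rfl⟩ | ⟨w, rfl, rfl⟩) (⟨w', h, rfl⟩ | ⟨w', h, rfl⟩)
    · rw [hinj _ n h]
    · exact key _ _ _ h.symm
    · exact (key _ _ _ h).symm
    · rw [hinj _ n h]
  · rintro n z x (⟨w, rfl, rfl⟩ | ⟨w, rfl, rfl⟩)
    · exact ConcreteCategory.congr_hom (NatTrans.congr_app hf n) w
    · exact ConcreteCategory.congr_hom (NatTrans.congr_app hg n) w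

end PushoutProduct

/-! ### Prisms -/

namespace Prism

variable {n : ℕ} {B : SemiSSet.{u}}

/-- The first components of the vertices of a simplex of `Δⁿ ⊗ B`. -/
def pos {m : ℕ} (z : (geomProd (simplex.{u} n) B).obj (op ⦋m⦌ₛ)) : Fin (m + 1) →o Fin (n + 1) :=
  z.1.1.toHom.toOrderHom

/-- The second component of a simplex of `Δⁿ ⊗ B`. -/
def snd {m : ℕ} (z : (geomProd (simplex.{u} n) B).obj (op ⦋m⦌ₛ)) : FreeSimplex B ⦋m⦌ := z.1.2

/-- The second components of the vertices of a simplex of `Δⁿ ⊗ B`. -/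
def height {m : ℕ} (z : (geomProd (simplex.{u} n) B).obj (op ⦋m⦌ₛ)) (a : Fin (m + 1)) : ℕ :=
  (snd z).val a

/-- The dimension of the underlying simplex of `B`. -/
def size {m : ℕ} (z : (geomProd (simplex.{u} n) B).obj (op ⦋m⦌ₛ)) : ℕ := (snd z).cod.len

section

variable {m : ℕ} (z : (geomProd (simplex.{u} n) B).obj (op ⦋m⦌ₛ))

lemma height_le (a : Fin (m + 1)) : height z a ≤ size z := (snd z).val_le a

lemma height_mono {a b : Fin (m + 1)} (h : a ≤ b) : height z a ≤ height z b := (snd z).val_mono h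

lemma eq_of_pos_eq {a b : Fin (m + 1)} (h₁ : pos z a = pos z b) (h₂ : height z a = height z b) :
    a = b :=
  (jointlyMono_iff _ _).1 ((FreeSimplex.jointlyMono_toHom_iff _ _).2 z.2) a b h₁ (Fin.ext h₂)

lemma ext {z z' : (geomProd (simplex.{u} n) B).obj (op ⦋m⦌ₛ)} (h₁ : ∀ a, pos z a = pos z' a)
    (h₂ : snd z = snd z') : z = z' := by
  refine geomProd.ext (FreeSimplex.toHom_injective ?_) h₂
  ext a : 3
  exact h₁ a

/-- A simplex of `Δⁿ ⊗ B` with given components. -/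
noncomputable def mk (φ : Fin (m + 1) →o Fin (n + 1))
    (y : FreeSimplex B ⦋m⦌)
    (h : ∀ a b : Fin (m + 1), φ a = φ b → y.val a = y.val b → a = b) :
    (geomProd (simplex.{u} n) B).obj (op ⦋m⦌ₛ) :=
  ⟨(FreeSimplex.ofHom (SimplexCategory.Hom.mk φ), y), by
    rw [← FreeSimplex.jointlyMono_toHom_iff, FreeSimplex.toHom_ofHom, jointlyMono_iff]
    exact fun a b h₁ h₂ => h a b h₁ (congrArg Fin.val h₂)⟩

lemma pos_mk (φ : Fin (m + 1) →o Fin (n + 1)) (y : FreeSimplex B ⦋m⦌)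
    (h : ∀ a b : Fin (m + 1), φ a = φ b → y.val a = y.val b → a = b) : pos (mk φ y h) = φ := by
  rw [pos, mk]
  dsimp only
  rw [FreeSimplex.toHom_ofHom]
  rfl

end

section

variable {m : ℕ} (z : (geomProd (simplex.{u} n) B).obj (op ⦋m + 1⦌ₛ)) (l : Fin (m + 2))

/-- The `l`-th face of a simplex. -/
noncomputable abbrev face : (geomProd (simplex.{u} n) B).obj (op ⦋m⦌ₛ) :=
  (geomProd (simplex.{u} n) B).map (coface l).op z

lemma pos_face (a : Fin (m + 1)) : pos (face z l) a = pos z (l.succAbove a) := by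
  refine SimplexCategory.congr_toOrderHom_apply (FreeSimplex.toHom_restrict z.1.1 _) a

lemma snd_face : snd (face z l) = (snd z).restrict (SimplexCategory.δ l) := by
  rw [snd, geomProd.snd_map]
  exact congrArg (snd z).restrict (toSimplexCategory_map_coface l)

lemma size_face_le : size (face z l) ≤ size z :=
  FreeSimplex.len_cod_restrict_le _ _

/-- If deleting a vertex leaves the second projection surjective, no renumbering of heights takes
place. -/
lemma height_face (h : size (face z l) = size z) (a : Fin (m + 1)) :
    height (face z l) a = height z (l.succAbove a) :=
  FreeSimplex.val_restrict_of_len_eq _ _ h a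

end

/-! ### Inserting a vertex next to a given one -/

/-- Of the two positions `j` and `j + 1`, the one at which a new vertex is inserted. -/
def near {m : ℕ} (s : Bool) (j : Fin (m + 1)) : Fin (m + 2) := if s then j.castSucc else j.succ

lemma predAbove_near {m : ℕ} (s : Bool) (j : Fin (m + 1)) : j.predAbove (near s j) = j := by
  cases s <;> simp [near]

lemma predAbove_succAbove_near {m : ℕ} (s : Bool) (j a : Fin (m + 1)) :
    j.predAbove ((near s j).succAbove a) = a := by
  cases s
  · exact SimplexCategory.congr_toOrderHom_apply (SimplexCategory.δ_comp_σ_succ (i := j)) a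
  · exact SimplexCategory.congr_toOrderHom_apply (SimplexCategory.δ_comp_σ_self (i := j)) a

lemma near_le_succAbove {m : ℕ} {s : Bool} {j a : Fin (m + 1)}
    (h : near s j ≤ (near s j).succAbove a) : if s then j ≤ a else j < a := by
  cases s <;> simp only [near, Fin.succAbove, Fin.lt_def, Fin.le_def] at * <;> simp at * <;>
    split_ifs at * <;> simp at * <;> omega

lemma succAbove_le_near {m : ℕ} {s : Bool} {j a : Fin (m + 1)}
    (h : (near s j).succAbove a ≤ near s j) : if s then a < j else a ≤ j := by
  cases s <;> simp only [near, Fin.succAbove, Fin.lt_def, Fin.le_def] at * <;> simp at * <;>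
    split_ifs at * <;> simp at * <;> omega

lemma exists_near {m : ℕ} {s : Bool} {i e : Fin (m + 2)}
    (h : if s then i.val + 1 = e.val else e.val + 1 = i.val) :
    ∃ j, near s j = i ∧ i.succAbove j = e := by
  cases s
  · simp only [Bool.false_eq_true, if_false] at h
    have hi : (⟨e, by omega⟩ : Fin (m + 1)).succ = i := Fin.ext h
    refine ⟨⟨e, by omega⟩, hi, ?_⟩
    exact Fin.succAbove_of_castSucc_lt _ _ (by rw [Fin.lt_def]; simp; omega)
  · simp only [if_true] at h
    have hi : (⟨i, by omega⟩ : Fin (m + 1)).castSucc = i := rfl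
    refine ⟨⟨i, by omega⟩, hi, ?_⟩
    exact (Fin.succAbove_of_le_castSucc _ _ le_rfl).trans (Fin.ext h)

/-- `j` is the last (if `s` holds: the first) position of the value `k'`. -/
def IsExtremal {m : ℕ} (s : Bool) (φ : Fin (m + 1) →o Fin (n + 1)) (k' : Fin (n + 1))
    (j : Fin (m + 1)) : Prop :=
  φ j = k' ∧ ∀ i, φ i = k' → if s then j ≤ i else i ≤ j

lemma IsExtremal.eq {m : ℕ} {s : Bool} {φ : Fin (m + 1) →o Fin (n + 1)} {k' : Fin (n + 1)}
    {j j' : Fin (m + 1)} (h : IsExtremal s φ k' j) (h' : IsExtremal s φ k' j') : j = j' := by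
  have h₁ := h.2 j' h'.1
  have h₂ := h'.2 j h.1
  cases s
  · exact le_antisymm h₂ h₁
  · exact le_antisymm h₁ h₂

lemma exists_isExtremal {m : ℕ} (s : Bool) (φ : Fin (m + 1) →o Fin (n + 1)) (k' : Fin (n + 1))
    (h : k' ∈ Set.range φ) : ∃ j, IsExtremal s φ k' j := by
  obtain ⟨a, ha⟩ := h
  have hne : (Finset.univ.filter fun i => φ i = k').Nonempty := ⟨a, by simpa using ha⟩
  cases s
  · obtain ⟨j, hj, hj'⟩ := Finset.exists_max_image _ id hne
    exact ⟨j, by simpa using hj, fun i hi => by simpa using hj' i (by simpa using hi)⟩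
  · obtain ⟨j, hj, hj'⟩ := Finset.exists_min_image _ id hne
    exact ⟨j, by simpa using hj, fun i hi => by simpa using hj' i (by simpa using hi)⟩

/-- The vertex `k'` is the successor of `k` (if `s` holds) or the predecessor of `k`. -/
def Adjacent (s : Bool) (k k' : Fin (n + 1)) : Prop :=
  if s then k.val + 1 = k'.val else k'.val + 1 = k.val

lemma Adjacent.ne {s : Bool} {k k' : Fin (n + 1)} (h : Adjacent s k k') : k ≠ k' := by
  rintro rfl
  cases s <;> simp [Adjacent] at h

/-- The assumption that the simplex has at least two vertices enters here. -/
lemma exists_adjacent {n : ℕ} (k : Fin (n + 2)) : ∃ s k', Adjacent s k k' := by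
  by_cases hk : k.val = 0
  · exact ⟨true, ⟨1, by omega⟩, by simp [Adjacent, hk]⟩
  · exact ⟨false, ⟨k - 1, by omega⟩, by simp [Adjacent]; omega⟩

/-- The map obtained by inserting the value `k` next to the position `j`. -/
def insertPos {m : ℕ} {s : Bool} {φ : Fin (m + 1) →o Fin (n + 1)} {k k' : Fin (n + 1)}
    {j : Fin (m + 1)} (hk : Adjacent s k k') (hj : IsExtremal s φ k' j) :
    Fin (m + 2) →o Fin (n + 1) where
  toFun := (near s j).insertNth k φ
  monotone' := by
    intro a b hab
    obtain rfl | ⟨a, rfl⟩ := Fin.eq_self_or_eq_succAbove (near s j) a <;>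
    obtain rfl | ⟨b, rfl⟩ := Fin.eq_self_or_eq_succAbove (near s j) b
    · exact le_rfl
    · simp only [Fin.insertNth_apply_same, Fin.insertNth_apply_succAbove]
      have h := near_le_succAbove hab
      have h₁ := hj.1
      have h₂ := hj.2 b
      cases s
      · simp only [Bool.false_eq_true, if_false, Adjacent] at *
        have h₃ := φ.monotone h.le
        -- Beyond the last position of k' the values exceed k', so they are at least k = k' + 1.
        have h₄ : φ b ≠ k' := fun e => absurd (h₂ e) (not_le.2 h)
        rw [h₁] at h₃
        rw [Fin.le_def] at *
        rw [ne_eq, Fin.ext_iff] at h₄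
        omega
      · simp only [if_true, Adjacent] at *
        have h₃ := φ.monotone h
        rw [h₁] at h₃
        rw [Fin.le_def] at *
        omega
    · simp only [Fin.insertNth_apply_same, Fin.insertNth_apply_succAbove]
      have h := succAbove_le_near hab
      have h₁ := hj.1
      have h₂ := hj.2 a
      cases s
      · simp only [Bool.false_eq_true, if_false, Adjacent] at *
        have h₃ := φ.monotone h
        rw [h₁] at h₃
        rw [Fin.le_def] at *
        omega
      · simp only [if_true, Adjacent] at *
        have h₃ := φ.monotone h.le
        have h₄ : φ a ≠ k' := fun e => absurd (h₂ e) (not_le.2 h)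
        rw [h₁] at h₃
        rw [Fin.le_def] at *
        rw [ne_eq, Fin.ext_iff] at h₄
        omega
    · simp only [Fin.insertNth_apply_succAbove]
      exact φ.monotone ((Fin.strictMono_succAbove _).le_iff_le.1 hab)

section

variable {m : ℕ} {s : Bool} {φ : Fin (m + 1) →o Fin (n + 1)} {k k' : Fin (n + 1)}
    {j : Fin (m + 1)} (hk : Adjacent s k k') (hj : IsExtremal s φ k' j)

lemma insertPos_near : insertPos hk hj (near s j) = k :=
  Fin.insertNth_apply_same (α := fun _ => Fin (n + 1)) (near s j) k φ

lemma insertPos_succAbove (a : Fin (m + 1)) : insertPos hk hj ((near s j).succAbove a) = φ a :=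
  Fin.insertNth_apply_succAbove (α := fun _ => Fin (n + 1)) (near s j) k φ a

end

end Prism

namespace Prism

/-! ### The pairing for the pushout product of a horn and a monomorphism -/

variable {n : ℕ} {A B : SemiSSet.{u}}

/-- The simplices of the union of `Λⁿ_k ⊗ B` and the image of `Δⁿ ⊗ A`. -/
def InUnion (k : Fin (n + 1)) (i : A ⟶ B) (m : ℕ)
    (z : (geomProd (simplex.{u} n) B).obj (op ⦋m⦌ₛ)) : Prop :=
  Set.range (pos z) ∪ {k} ≠ Set.univ ∨ ∃ w : FreeSimplex A ⦋m⦌, w.map i = snd z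

/-- The part of the rank of a simplex that depends on the height of a vertex. -/
def weight (s : Bool) {m : ℕ} (z : (geomProd (simplex.{u} n) B).obj (op ⦋m⦌ₛ))
    (j : Fin (m + 1)) : ℕ :=
  if s then size z - height z j else height z j

/-- `σ` arises from `τ` by inserting the vertex `(k, y)` next to the extremal vertex `(k', y)`
whose first component is `k'`. -/
def IsInsertion (s : Bool) (k k' : Fin (n + 1)) (i : A ⟶ B) {m : ℕ}
    (τ : (geomProd (simplex.{u} n) B).obj (op ⦋m⦌ₛ))
    (σ : (geomProd (simplex.{u} n) B).obj (op ⦋m + 1⦌ₛ)) (l : Fin (m + 2))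
    (r : ℕ ×ₗ ℕ ×ₗ ℕ) : Prop :=
  ∃ j, l = near s j ∧ IsExtremal s (pos τ) k' j ∧ pos σ l = k ∧
    (∀ a, pos σ (l.succAbove a) = pos τ a) ∧ (snd σ) = (snd τ).restrict (SimplexCategory.σ j) ∧
    ¬ InUnion k i m τ ∧ r = toLex (size τ, toLex (weight s τ j, m))

section

variable {s : Bool} {k k' : Fin (n + 1)} {i : A ⟶ B} {m : ℕ}
  {τ : (geomProd (simplex.{u} n) B).obj (op ⦋m⦌ₛ)}
  {σ : (geomProd (simplex.{u} n) B).obj (op ⦋m + 1⦌ₛ)} {l : Fin (m + 2)} {r : ℕ ×ₗ ℕ ×ₗ ℕ}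

lemma size_of_eq_restrict {j : Fin (m + 1)} (h : (snd σ) = (snd τ).restrict (SimplexCategory.σ j)) :
    size σ = size τ := by
  rw [size, h, FreeSimplex.cod_restrict_of_epi]
  rfl

lemma height_of_eq_restrict {j : Fin (m + 1)} (h : (snd σ) = (snd τ).restrict (SimplexCategory.σ j))
    (a : Fin (m + 2)) : height σ a = height τ (j.predAbove a) := by
  rw [height, h]
  exact FreeSimplex.val_restrict_of_epi _ _ _

lemma IsInsertion.face_eq (h : IsInsertion s k k' i τ σ l r) : face σ l = τ := by
  obtain ⟨j, rfl, -, -, h₁, h₂, -, -⟩ := h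
  refine ext (fun a => (pos_face _ _ _).trans (h₁ a)) ?_
  rw [snd_face, h₂, ← FreeSimplex.restrict_comp]
  have : SimplexCategory.δ (near s j) ≫ SimplexCategory.σ j = 𝟙 _ := by
    ext a : 3
    exact predAbove_succAbove_near s j a
  rw [this]
  exact FreeSimplex.restrict_id _

lemma IsInsertion.unique {σ' : (geomProd (simplex.{u} n) B).obj (op ⦋m + 1⦌ₛ)} {l' : Fin (m + 2)}
    {r' : ℕ ×ₗ ℕ ×ₗ ℕ} (h : IsInsertion s k k' i τ σ l r) (h' : IsInsertion s k k' i τ σ' l' r') :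
    σ = σ' := by
  obtain ⟨j, rfl, hj, hk, h₁, h₂, -, -⟩ := h
  obtain ⟨j', rfl, hj', hk', h₁', h₂', -, -⟩ := h'
  obtain rfl := hj.eq hj'
  refine ext (fun a => ?_) (h₂.trans h₂'.symm)
  obtain rfl | ⟨a, rfl⟩ := Fin.eq_self_or_eq_succAbove (near s j) a
  · rw [hk, hk']
  · rw [h₁, h₁']

/-- The extremal vertex of `τ` is extremal in `σ`. -/
lemma isExtremal_succAbove (hk : k ≠ k') {j : Fin (m + 1)} (hj : IsExtremal s (pos τ) k' j)
    (h₁ : pos σ l = k) (h₂ : ∀ a, pos σ (l.succAbove a) = pos τ a) :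
    IsExtremal s (pos σ) k' (l.succAbove j) := by
  refine ⟨(h₂ j).trans hj.1, fun a ha => ?_⟩
  obtain rfl | ⟨a, rfl⟩ := Fin.eq_self_or_eq_succAbove l a
  · exact absurd (h₁.symm.trans ha) hk
  · rw [h₂] at ha
    have := hj.2 a ha
    cases s
    · exact (Fin.strictMono_succAbove l).monotone this
    · exact (Fin.strictMono_succAbove l).monotone this

/-- Inserting (k, y) does not change the extremal vertex (k', y). A second insertion would therefore
add (k, y) again, contradicting joint monicity. -/
lemma IsInsertion.not_isInsertion (hk : k ≠ k')
    {υ : (geomProd (simplex.{u} n) B).obj (op ⦋m + 1 + 1⦌ₛ)} {l' : Fin (m + 1 + 2)}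
    {r' : ℕ ×ₗ ℕ ×ₗ ℕ} (h : IsInsertion s k k' i σ υ l' r') : ¬ IsInsertion s k k' i τ σ l r := by
  intro h'
  obtain ⟨j, rfl, hj, hυ, h₁, h₂, -, -⟩ := h
  obtain ⟨j', rfl, hj', hσ, h₁', h₂', -, -⟩ := h'
  obtain rfl := hj.eq (isExtremal_succAbove hk hj' hσ h₁')
  refine Fin.succAbove_ne _ _ (eq_of_pos_eq υ ((h₁ (near s j')).trans (hσ.trans hυ.symm)) ?_)
  rw [height_of_eq_restrict h₂, height_of_eq_restrict h₂, predAbove_near, predAbove_succAbove_near,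
    height_of_eq_restrict h₂', height_of_eq_restrict h₂', predAbove_near,
    predAbove_succAbove_near]

/-- A simplex with vertices `(k, y)` and `(k', y)`, where the latter is extremal, is obtained by
inserting `(k, y)` in a face. -/
lemma exists_isInsertion_right (hk : Adjacent s k k') (hσ : ¬ InUnion k i (m + 1) σ)
    {e l : Fin (m + 2)} (he : IsExtremal s (pos σ) k' e) (hl : pos σ l = k)
    (hle : height σ l = height σ e) :
    ∃ τ, IsInsertion s k k' i τ σ l (toLex (size σ, toLex (weight s σ e, m))) := by
  -- The two vertices are consecutive in the chain: a vertex strictly between them would have the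
  -- same height and a first component between the neighbouring values k and k', so it would
  -- coincide with one of them.
  have hadj : if s then l.val + 1 = e.val else e.val + 1 = l.val := by
    have hbetween : ∀ a, min l e < a → a < max l e → False := by
      intro a h₁ h₂
      have h₃ : height σ a = height σ e := by
        obtain h | h := le_total l e
        · rw [min_eq_left h] at h₁
          rw [max_eq_right h] at h₂
          exact le_antisymm (height_mono σ h₂.le) (hle ▸ height_mono σ h₁.le)
        · rw [min_eq_right h] at h₁
          rw [max_eq_left h] at h₂
          exact le_antisymm (hle ▸ height_mono σ h₂.le) (height_mono σ h₁.le)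
      have h₄ : pos σ a ≠ k := fun h => by
        obtain rfl := eq_of_pos_eq σ (h.trans hl.symm) (h₃.trans hle.symm)
        simp at h₁ h₂
        exact lt_asymm h₁ h₂
      have h₅ : pos σ a ≠ k' := fun h => by
        obtain rfl := eq_of_pos_eq σ (h.trans he.1.symm) h₃
        simp at h₁ h₂
        exact lt_asymm h₁ h₂
      have h₆ := (pos σ).monotone h₁.le
      have h₇ := (pos σ).monotone h₂.le
      rw [(pos σ).monotone.map_min, hl, he.1] at h₆
      rw [(pos σ).monotone.map_max, hl, he.1] at h₇
      rw [Fin.le_def] at h₆ h₇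
      rw [ne_eq, Fin.ext_iff] at h₄ h₅
      cases s <;> simp [Adjacent] at hk <;> grind
    have hlt : if s then l < e else e < l := by
      cases s
      · by_contra h
        simp only [Bool.false_eq_true, if_false, not_lt] at h
        have := (pos σ).monotone h
        rw [hl, he.1, Fin.le_def] at this
        simp [Adjacent] at hk
        omega
      · by_contra h
        simp only [if_true, not_lt] at h
        have := (pos σ).monotone h
        rw [hl, he.1, Fin.le_def] at this
        simp [Adjacent] at hk
        omega
    cases s
    · simp only [Bool.false_eq_true, if_false] at hlt ⊢
      by_contra h
      refine hbetween ⟨e + 1, by omega⟩ ?_ ?_ <;>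
        simp only [lt_max_iff, min_lt_iff, Fin.lt_def] at * <;> omega
    · simp only [if_true] at hlt ⊢
      by_contra h
      refine hbetween ⟨l + 1, by omega⟩ ?_ ?_ <;>
        simp only [lt_max_iff, min_lt_iff, Fin.lt_def] at * <;> omega
  obtain ⟨j, rfl, rfl⟩ := exists_near hadj
  -- The vertices l and e have equal heights, so deleting l and then doubling e restores the second
  -- component.
  have hsnd : (snd σ) = (snd (face σ (near s j))).restrict (SimplexCategory.σ j) := by
    rw [snd_face, ← FreeSimplex.restrict_comp]
    refine (FreeSimplex.restrict_eq_self _ _ ?_).symm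
    ext a : 3
    refine Fin.ext ?_
    change height σ ((near s j).succAbove (j.predAbove a)) = height σ a
    obtain rfl | ⟨a, rfl⟩ := Fin.eq_self_or_eq_succAbove (near s j) a
    · rw [predAbove_near, hle]
    · rw [predAbove_succAbove_near]
  refine ⟨face σ (near s j), j, rfl, ⟨?_, ?_⟩, hl, fun a => (pos_face _ _ _).symm, hsnd, ?_, ?_⟩
  · rw [pos_face, he.1]
  · intro a ha
    rw [pos_face] at ha
    have := he.2 _ ha
    cases s
    · exact (Fin.strictMono_succAbove _).le_iff_le.1 this
    · exact (Fin.strictMono_succAbove _).le_iff_le.1 this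
  -- Deleting a vertex over k does not affect the union of the image with {k}; and if the second
  -- component of the face came from A, so would its degeneracy, which is that of σ.
  · rintro (h | ⟨w, hw⟩)
    · refine hσ (Or.inl fun h' => h (Set.eq_univ_of_univ_subset (h'.symm.subset.trans ?_)))
      rintro x (⟨a, rfl⟩ | hx)
      · obtain rfl | ⟨a, rfl⟩ := Fin.eq_self_or_eq_succAbove (near s j) a
        · exact Or.inr hl
        · exact Or.inl ⟨a, pos_face _ _ _⟩
      · exact Or.inr hx
    · exact hσ (Or.inr ⟨w.restrict (SimplexCategory.σ j), by
        rw [FreeSimplex.map_restrict, hw, ← hsnd]⟩)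
  · rw [weight, weight, size_of_eq_restrict hsnd, height_of_eq_restrict hsnd,
      predAbove_succAbove_near]

/-- The hypothesis `h` says that (k, y) is not yet a vertex, which is what keeps the enlarged chain
jointly monic. -/
lemma exists_isInsertion_left (hk : Adjacent s k k') (hτ : ¬ InUnion k i m τ)
    {j : Fin (m + 1)} (hj : IsExtremal s (pos τ) k' j)
    (h : ∀ a, pos τ a = k → height τ a ≠ height τ j) :
    ∃ σ, IsInsertion s k k' i τ σ (near s j) (toLex (size τ, toLex (weight s τ j, m))) := by
  have hval : ∀ a : Fin (m + 2), ((snd τ).restrict (SimplexCategory.σ j)).val a =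
      height τ (j.predAbove a) := FreeSimplex.val_restrict_of_epi _ _
  refine ⟨mk (insertPos hk hj) ((snd τ).restrict (SimplexCategory.σ j)) ?_, j, rfl, hj, ?_, ?_,
    rfl, hτ, rfl⟩
  · intro a b h₁ h₂
    rw [hval, hval] at h₂
    obtain rfl | ⟨a, rfl⟩ := Fin.eq_self_or_eq_succAbove (near s j) a <;>
    obtain rfl | ⟨b, rfl⟩ := Fin.eq_self_or_eq_succAbove (near s j) b
    · rfl
    · rw [insertPos_near, insertPos_succAbove] at h₁
      rw [predAbove_near, predAbove_succAbove_near] at h₂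
      exact absurd h₂.symm (h b h₁.symm)
    · rw [insertPos_succAbove, insertPos_near] at h₁
      rw [predAbove_near, predAbove_succAbove_near] at h₂
      exact absurd h₂ (h a h₁)
    · rw [insertPos_succAbove, insertPos_succAbove] at h₁
      rw [predAbove_succAbove_near, predAbove_succAbove_near] at h₂
      rw [eq_of_pos_eq τ h₁ h₂]
  · rw [pos_mk]
    exact insertPos_near hk hj
  · intro a
    rw [pos_mk]
    exact insertPos_succAbove hk hj a

lemma exists_isExtremal_of_not_inUnion (hk : k ≠ k') (hτ : ¬ InUnion k i m τ) :
    ∃ j, IsExtremal s (pos τ) k' j := by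
  refine exists_isExtremal s _ k' ?_
  have h : Set.range (pos τ) ∪ {k} = Set.univ := by
    by_contra h
    exact hτ (Or.inl h)
  have : k' ∈ Set.range (pos τ) ∪ {k} := h ▸ Set.mem_univ _
  exact this.resolve_right fun h => hk h.symm

/-- Every simplex outside of the union belongs to a pair, whose rank is bounded in terms of the
simplex. -/
lemma mem_of_isInsertion (hk : Adjacent s k k') (hτ : ¬ InUnion k i m τ)
    {j : Fin (m + 1)} (hj : IsExtremal s (pos τ) k' j)
    (D : ∀ m : ℕ, (geomProd (simplex.{u} n) B).obj (op ⦋m⦌ₛ) → Prop)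
    (hD : ∀ {m'} {τ' : (geomProd (simplex.{u} n) B).obj (op ⦋m'⦌ₛ)} {σ' l' r'},
      ((∃ a, pos τ a = k ∧ height τ a = height τ j) →
        r' < toLex (size τ, toLex (weight s τ j, m))) →
      r' ≤ toLex (size τ, toLex (weight s τ j, m)) →
      IsInsertion s k k' i τ' σ' l' r' → D m' τ' ∧ D (m' + 1) σ') : D m τ := by
  by_cases h : ∃ a, pos τ a = k ∧ height τ a = height τ j
  · obtain ⟨a, ha, ha'⟩ := h
    cases m with
    | zero =>
      -- A single vertex cannot lie over both k and k'.
      obtain rfl : a = j := Subsingleton.elim (α := Fin 1) _ _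
      exact absurd (ha.symm.trans hj.1) hk.ne
    | succ m =>
      obtain ⟨τ', hτ'⟩ := exists_isInsertion_right hk hτ hj ha ha'
      -- The last entry of a rank is the dimension of the smaller member of the pair, so being the
      -- larger member lowers it by one.
      have hlt : toLex (size τ, toLex (weight s τ j, m)) <
          toLex (size τ, toLex (weight s τ j, m + 1)) :=
        Prod.Lex.toLex_lt_toLex.2 (Or.inr ⟨rfl, Prod.Lex.toLex_lt_toLex.2
          (Or.inr ⟨rfl, Nat.lt_succ_self m⟩)⟩)
      exact (hD (fun _ => hlt) hlt.le hτ').2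
  · push Not at h
    obtain ⟨σ', hσ'⟩ := exists_isInsertion_left hk hτ hj h
    refine (hD (fun ⟨a, ha, ha'⟩ => absurd ha' (h a ha)) le_rfl hσ').1

/-- Each entry of the rank handles one kind of face. If the face has a smaller underlying simplex of
B, the size drops. If (k', y) is deleted, the next extremal vertex lies farther from column k along
the chain, and the weight drops. Any other face keeps both (k, y) and (k', y), so it is the larger
member of its pair, and the dimension entry drops. -/
lemma IsInsertion.mem_face (hk : Adjacent s k k') (h : IsInsertion s k k' i τ σ l r)
    {l' : Fin (m + 2)} (hl : l' ≠ l)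
    (D : ∀ m : ℕ, (geomProd (simplex.{u} n) B).obj (op ⦋m⦌ₛ) → Prop)
    (hS : ∀ m z, InUnion k i m z → D m z)
    (hD : ∀ {m'} {τ' : (geomProd (simplex.{u} n) B).obj (op ⦋m'⦌ₛ)} {σ' l' r'},
      r' < r → IsInsertion s k k' i τ' σ' l' r' → D m' τ' ∧ D (m' + 1) σ') : D m (face σ l') := by
  by_cases hρ : InUnion k i m (face σ l')
  · exact hS _ _ hρ
  obtain ⟨j, rfl, hj, hσ, h₁, h₂, hτ, rfl⟩ := h
  obtain ⟨e, he⟩ := exists_isExtremal_of_not_inUnion (s := s) hk.ne hρ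
  have hfar := isExtremal_succAbove hk.ne hj hσ h₁
  have hsize : size σ = size τ := size_of_eq_restrict h₂
  have hfarh : height σ ((near s j).succAbove j) = height τ j := by
    rw [height_of_eq_restrict h₂, predAbove_succAbove_near]
  have hnearh : height σ (near s j) = height τ j := by
    rw [height_of_eq_restrict h₂, predAbove_near]
  refine mem_of_isInsertion hk hρ he D fun {m' τ' σ' l'' r'} hr hr' hpair => hD ?_ hpair
  obtain hlt | heq := lt_or_eq_of_le ((size_face_le σ l').trans hsize.le)
  · exact hr'.trans_lt (Prod.Lex.toLex_lt_toLex.2 (Or.inl hlt))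
  have hheight := height_face σ l' (heq.trans hsize.symm)
  have hee : pos σ (l'.succAbove e) = k' := (pos_face _ _ _).symm.trans he.1
  -- From here on the size is unchanged, so heights in the face are heights in σ.
  by_cases hl' : l' = (near s j).succAbove j
  · have hle := hfar.2 _ hee
    -- Two vertices over k' cannot have the same height, so the weight changes strictly.
    have hne : height (face σ l') e ≠ height τ j := by
      intro h
      rw [hheight, ← hfarh] at h
      have := eq_of_pos_eq σ (hee.trans hfar.1.symm) h
      rw [← hl'] at this
      exact Fin.succAbove_ne _ _ this
    refine hr'.trans_lt (Prod.Lex.toLex_lt_toLex.2 (Or.inr ⟨heq, Prod.Lex.toLex_lt_toLex.2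
      (Or.inl ?_)⟩))
    have hbd := height_le (face σ l') e
    rw [weight, weight, heq]
    rw [heq] at hbd
    cases s
    · have := height_mono σ (show _ ≤ _ from hle)
      rw [hfarh, ← hheight] at this
      exact lt_of_le_of_ne this hne
    · have := height_mono σ (show _ ≤ _ from hle)
      rw [hfarh, ← hheight] at this
      simp only [if_true]
      omega
  · obtain h | ⟨j', hj'⟩ := Fin.eq_self_or_eq_succAbove l' ((near s j).succAbove j)
    · exact absurd h.symm hl'
    obtain h | ⟨a, ha⟩ := Fin.eq_self_or_eq_succAbove l' (near s j)
    · exact absurd h.symm hl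
    have hext : IsExtremal s (pos (face σ l')) k' j' := by
      refine ⟨by rw [pos_face, ← hj', hfar.1], fun b hb => ?_⟩
      rw [pos_face] at hb
      have := hfar.2 _ hb
      rw [hj'] at this
      cases s
      · exact (Fin.strictMono_succAbove _).le_iff_le.1 this
      · exact (Fin.strictMono_succAbove _).le_iff_le.1 this
    obtain rfl := he.eq hext
    have hw : weight s (face σ l') e = weight s τ j := by
      rw [weight, weight, heq, hheight, ← hj', hfarh]
    rw [heq, hw] at hr
    refine hr ⟨a, ?_, ?_⟩
    · rw [pos_face, ← ha, hσ]
    · rw [hheight, hheight, ← ha, ← hj', hfarh, hnearh]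

theorem isPairing (hk : Adjacent s k k') (i : A ⟶ B) :
    IsPairing (InUnion k i) (fun {m} => IsInsertion s k k' i (m := m)) where
  face h := h.face_eq
  notMem := by
    rintro m τ σ l r ⟨j, -, -, -, -, -, h, -⟩
    exact h
  unique h h' := h.unique h'
  disjoint {m} := by
    intro ρ τ σ l r l' r' h
    exact h.not_isInsertion hk.ne
  cover D hS hD m z := by
    by_cases hz : InUnion k i m z
    · exact hS _ _ hz
    obtain ⟨j, hj⟩ := exists_isExtremal_of_not_inUnion (s := s) hk.ne hz
    exact mem_of_isInsertion hk hz hj D fun _ _ h => hD h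
  otherFace h j hj D hS hD := h.mem_face hk hj D hS hD

end

end Prism

/-- The map given on the union is a partial lift, and the pairing of the complement extends it to
Δⁿ⁺¹ ⊗ B. What remains is that `Prism.InUnion` describes the domain of this partial lift: a simplex
lies over the horn when the image of its first component does, the first projection being
surjective. -/
theorem pushoutProductLifting_horn {n : ℕ} (k : Fin (n + 2)) {A B X Y : SemiSSet.{u}} (i : A ⟶ B)
    [Mono i] {p : X ⟶ Y} (hp : fibrations p) :
    PushoutProductLifting (horn.{u} (n + 1) k).ι i p := by
  intro f g t hfg hf hg
  obtain ⟨s, k', hk⟩ := Prism.exists_adjacent k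
  obtain ⟨l, hl, hR⟩ := (Prism.isPairing hk i).exists_lift hp
    (isPartialLift_pushoutProductGraph _ i f g t p hfg hf hg) (fun m z => by
      constructor
      · rintro (h | ⟨w, hw⟩)
        · have hmem : MemHorn k (ULift.down z.1.1.elt : z.1.1.cod ⟶ ⦋n + 1⦌ₛ) := by
            intro e
            refine h (Set.eq_univ_of_univ_subset (e.symm.subset.trans ?_))
            refine Set.union_subset_union_left _ ?_
            rintro _ ⟨x, rfl⟩
            obtain ⟨a, rfl⟩ := SimplexCategory.epi_iff_surjective.1 z.1.1.epi x
            exact ⟨a, rfl⟩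
          exact ⟨_, Or.inl ⟨⟨(⟨z.1.1.cod, z.1.1.proj, z.1.1.epi, ⟨z.1.1.elt, hmem⟩⟩, z.1.2), z.2⟩,
            rfl, rfl⟩⟩
        · have hm : JointlyMono z.1.1.proj w.proj := by
            have := z.2
            rw [show z.1.2 = Prism.snd z from rfl, ← hw] at this
            exact this
          exact ⟨_, Or.inr ⟨⟨(z.1.1, w), hm⟩, geomProd.ext rfl hw, rfl⟩⟩
      · rintro ⟨x, ⟨w, rfl, -⟩ | ⟨w, rfl, -⟩⟩
        · refine Or.inl fun h => w.1.1.elt.2 (Set.eq_univ_of_univ_subset (h.symm.subset.trans ?_))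
          refine Set.union_subset_union_left _ ?_
          rintro _ ⟨x, rfl⟩
          exact ⟨_, rfl⟩
        · exact Or.inr ⟨w.1.2, rfl⟩)
  refine ⟨l, ?_, ?_, hl⟩
  · ext m w
    exact hR _ _ _ (Or.inl ⟨w, rfl, rfl⟩)
  · ext m w
    exact hR _ _ _ (Or.inr ⟨w, rfl, rfl⟩)

variable {A A' B K L X Y Z : SemiSSet.{u}}

/-! ### Symmetry of the geometric product -/

/-- The symmetry of the geometric product. -/
noncomputable def geomProdSwap (A B : SemiSSet.{u}) : geomProd A B ⟶ geomProd B A where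
  app _ := ↾fun z => ⟨(z.1.2, z.1.1), fun _ s t h₁ h₂ => z.2 s t h₂ h₁⟩

@[simp]
lemma geomProdSwap_swap (A B : SemiSSet.{u}) : geomProdSwap A B ≫ geomProdSwap B A = 𝟙 _ := rfl

lemma geomProdSwap_swap_assoc (h : geomProd A B ⟶ Z) :
    geomProdSwap A B ≫ geomProdSwap B A ≫ h = h := by
  rw [← Category.assoc, geomProdSwap_swap, Category.id_comp]

lemma geomProdSwap_naturality (f : A ⟶ K) (g : B ⟶ L) :
    geomProdSwap A B ≫ geomProdMap g f = geomProdMap f g ≫ geomProdSwap K L := rfl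

lemma geomProdSwap_naturality_assoc (f : A ⟶ K) (g : B ⟶ L) (h : geomProd L K ⟶ Z) :
    geomProdSwap A B ≫ geomProdMap g f ≫ h = geomProdMap f g ≫ geomProdSwap K L ≫ h := by
  rw [← Category.assoc, geomProdSwap_naturality, Category.assoc]

lemma geomProdMap_comp_map {A' A'' B' B'' : SemiSSet.{u}} (f : A ⟶ A') (f' : A' ⟶ A'')
    (g : B ⟶ B') (g' : B' ⟶ B'') :
    geomProdMap f g ≫ geomProdMap f' g' = geomProdMap (f ≫ f') (g ≫ g') := rfl

lemma geomProdMap_comp_map_assoc {A' A'' B' B'' : SemiSSet.{u}} (f : A ⟶ A') (f' : A' ⟶ A'')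
    (g : B ⟶ B') (g' : B' ⟶ B'') (h : geomProd A'' B'' ⟶ Z) :
    geomProdMap f g ≫ geomProdMap f' g' ≫ h = geomProdMap (f ≫ f') (g ≫ g') ≫ h := by
  rw [← Category.assoc, geomProdMap_comp_map]

lemma PushoutProductLifting.symm {j : K ⟶ L} {i : A ⟶ B} {p : X ⟶ Y}
    (h : PushoutProductLifting j i p) : PushoutProductLifting i j p := by
  intro f g t h₁ h₂ h₃
  obtain ⟨l, hl₁, hl₂, hl₃⟩ := h (geomProdSwap _ _ ≫ g) (geomProdSwap _ _ ≫ f)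
    (geomProdSwap _ _ ≫ t)
    (by rw [← geomProdSwap_naturality_assoc, ← h₁, geomProdSwap_naturality_assoc])
    (by rw [Category.assoc, h₃, geomProdSwap_naturality_assoc])
    (by rw [Category.assoc, h₂, geomProdSwap_naturality_assoc])
  refine ⟨geomProdSwap _ _ ≫ l, ?_, ?_, ?_⟩
  · rw [← geomProdSwap_naturality_assoc, hl₂, geomProdSwap_swap_assoc]
  · rw [← geomProdSwap_naturality_assoc, hl₁, geomProdSwap_swap_assoc]
  · rw [Category.assoc, hl₃, geomProdSwap_swap_assoc]

lemma PushoutProductLifting.of_iso {K' : SemiSSet.{u}} {j : K ⟶ L} {i : A ⟶ B} {p : X ⟶ Y}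
    (h : PushoutProductLifting j i p) (e : K' ≅ K) : PushoutProductLifting (e.hom ≫ j) i p := by
  intro f g t h₁ h₂ h₃
  obtain ⟨l, hl₁, hl₂, hl₃⟩ := h (geomProdMap e.inv (𝟙 B) ≫ f) g t
    (by
      have : geomProdMap j (𝟙 A) = geomProdMap e.inv (𝟙 A) ≫ geomProdMap (e.hom ≫ j) (𝟙 A) := by
        rw [← geomProdMap_comp, e.inv_hom_id_assoc]
        rfl
      rw [this, Category.assoc, ← h₁, geomProdMap_comp_map_assoc, geomProdMap_comp_map_assoc]
      rfl)
    (by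
      rw [Category.assoc, h₂, geomProdMap_comp_map_assoc, e.inv_hom_id_assoc]
      rfl) h₃
  refine ⟨l, ?_, hl₂, hl₃⟩
  have : geomProdMap (e.hom ≫ j) (𝟙 B) = geomProdMap e.hom (𝟙 B) ≫ geomProdMap j (𝟙 B) := rfl
  rw [this, Category.assoc, hl₁, geomProdMap_comp_map_assoc, e.hom_inv_id]
  rfl

/-! ### Mapping spaces -/

/-- The mapping space, whose `n`-simplices are the maps `Δⁿ ⊗ K ⟶ Y`. -/
noncomputable def mapSpace (K Y : SemiSSet.{u}) : SemiSSet.{u} where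
  obj n := geomProd (uliftYoneda.{u}.obj n.unop) K ⟶ Y
  map f := ↾fun α => geomProdMap (uliftYoneda.{u}.map f.unop) (𝟙 K) ≫ α
  map_id n := by
    refine ConcreteCategory.hom_ext _ _ fun (α : geomProd (uliftYoneda.{u}.obj n.unop) K ⟶ Y) => ?_
    change geomProdMap (uliftYoneda.{u}.map (𝟙 n.unop)) (𝟙 K) ≫ α = α
    rw [CategoryTheory.Functor.map_id]
    rfl
  map_comp {n _ _} f g := by
    refine ConcreteCategory.hom_ext _ _ fun (α : geomProd (uliftYoneda.{u}.obj n.unop) K ⟶ Y) => ?_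
    change geomProdMap (uliftYoneda.{u}.map (g.unop ≫ f.unop)) (𝟙 K) ≫ α = _
    rw [CategoryTheory.Functor.map_comp]
    rfl

/-- Postcomposition on mapping spaces. -/
noncomputable def mapSpacePost (K : SemiSSet.{u}) (p : X ⟶ Y) : mapSpace K X ⟶ mapSpace K Y where
  app n := ↾fun (α : geomProd (uliftYoneda.{u}.obj n.unop) K ⟶ X) => (α ≫ p :)

/-- Precomposition on mapping spaces. -/
noncomputable def mapSpacePre (i : A ⟶ B) (Y : SemiSSet.{u}) :
    mapSpace B Y ⟶ mapSpace A Y where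
  app n := ↾fun (α : geomProd (uliftYoneda.{u}.obj n.unop) B ⟶ Y) =>
    (geomProdMap (𝟙 _) i ≫ α :)

/-- The tautological simplex of `Δᵃ` underlying a simplex with underlying element in `A_a`. -/
def FreeSimplex.taut {S : SimplexCategory} (z : FreeSimplex A S) :
    FreeSimplex (uliftYoneda.{u}.obj z.cod) S :=
  ⟨z.cod, z.proj, z.epi, ULift.up (𝟙 _)⟩

lemma uliftYoneda_map_app_id {a b : SemiSimplexCategory} (i : a ⟶ b) :
    (uliftYoneda.{u}.map i).app (op a) (ULift.up (𝟙 a)) =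
      (uliftYoneda.{u}.obj b).map i.op (ULift.up (𝟙 b)) := by
  apply ULift.down_injective
  simp

/-- This is the compatibility behind the naturality of `uncurry`: both sides carry the embedding
from the epi-mono factorization as their element. -/
lemma FreeSimplex.taut_restrict {S T : SimplexCategory} (f : T ⟶ S) (z : FreeSimplex A S) :
    (z.restrict f).taut.map (uliftYoneda.{u}.map (factIncl (f ≫ z.proj))) =
      z.taut.restrict f := by
  exact congrArg (FreeSimplex.mk (A := uliftYoneda.{u}.obj z.cod) (factObj (f ≫ z.proj))
    (factProj (f ≫ z.proj)) inferInstance) (uliftYoneda_map_app_id (factIncl (f ≫ z.proj)))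

lemma FreeSimplex.taut_map {S : SimplexCategory} {c : SemiSimplexCategory}
    (z : FreeSimplex (uliftYoneda.{u}.obj c) S) :
    z.taut.map (uliftYoneda.{u}.map (ULift.down z.elt : z.cod ⟶ c)) = z := by
  obtain ⟨d, q, hq, ⟨g⟩⟩ := z
  have h : (uliftYoneda.{u}.map (g : d ⟶ c)).app (op d) (ULift.up (𝟙 d)) = ULift.up g := by
    apply ULift.down_injective
    simp
  exact congrArg (FreeSimplex.mk d q hq) h

/-- The value at the element `u a` of the mapping space. -/
noncomputable abbrev mapSpace.toHom {n} (α : (mapSpace K Y).obj n) :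
    geomProd (uliftYoneda.{u}.obj n.unop) K ⟶ Y := α

/-- The map `A ⊗ K ⟶ Y` corresponding to a map from `A` to the mapping space. -/
noncomputable def uncurry (f : A ⟶ mapSpace K Y) : geomProd A K ⟶ Y where
  app n := ↾fun z => (mapSpace.toHom (f.app (op z.1.1.cod) z.1.1.elt)).app n
    ⟨(z.1.1.taut, z.1.2), z.2⟩
  naturality n m a := by
    ext z
    have h := NatTrans.naturality_apply f
      (factIncl (toSimplexCategory.map a.unop ≫ z.1.1.proj)).op z.1.1.elt
    change (mapSpace.toHom (f.app _ (A.map _ z.1.1.elt))).app m _ = Y.map a _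
    refine (congrArg (fun α => (mapSpace.toHom α).app m _) h).trans ?_
    change (mapSpace.toHom (f.app (op z.1.1.cod) z.1.1.elt)).app m _ = _
    refine Eq.trans ?_ (NatTrans.naturality_apply
      (mapSpace.toHom (f.app (op z.1.1.cod) z.1.1.elt)) a ⟨(z.1.1.taut, z.1.2), z.2⟩)
    refine congrArg _ (geomProd.ext ?_ rfl)
    exact FreeSimplex.taut_restrict _ _

/-- The map classifying a simplex. -/
noncomputable def ofElt {n} (a : A.obj n) : uliftYoneda.{u}.obj n.unop ⟶ A :=
  uliftYonedaEquiv.symm a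

lemma ofElt_map {n m} (f : n ⟶ m) (a : A.obj n) :
    ofElt (A.map f a) = uliftYoneda.{u}.map f.unop ≫ ofElt a :=
  uliftYonedaEquiv_symm_map f a

/-- The map to the mapping space corresponding to a map from `A ⊗ K` to `Y`. -/
noncomputable def curry (h : geomProd A K ⟶ Y) : A ⟶ mapSpace K Y where
  app n := ↾fun a => (geomProdMap (ofElt a) (𝟙 K) ≫ h :)
  naturality n m f := by
    refine ConcreteCategory.hom_ext _ _ fun a => ?_
    change geomProdMap (ofElt (A.map f a)) (𝟙 K) ≫ h = geomProdMap _ (𝟙 K) ≫ _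
    rw [ofElt_map]
    rfl

@[simp]
lemma uncurry_curry (h : geomProd A K ⟶ Y) : uncurry (curry h) = h := by
  ext n z
  change h.app n _ = _
  refine congrArg _ (geomProd.ext ?_ rfl)
  refine congrArg (FreeSimplex.mk z.1.1.cod z.1.1.proj z.1.1.epi) ?_
  exact ConcreteCategory.congr_hom (A.map_id _) _

@[simp]
lemma curry_uncurry (f : A ⟶ mapSpace K Y) : curry (uncurry f) = f := by
  ext n : 2
  refine ConcreteCategory.hom_ext _ _ fun a => ?_
  change geomProdMap (ofElt a) (𝟙 K) ≫ uncurry f = mapSpace.toHom (f.app n a)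
  ext m w
  have h := NatTrans.naturality_apply f (Quiver.Hom.op (ULift.down w.1.1.elt : _ ⟶ n.unop)) a
  change (mapSpace.toHom (f.app _ (A.map _ a))).app m _ = _
  refine (congrArg (fun α => (mapSpace.toHom α).app m _) h).trans ?_
  change (mapSpace.toHom (f.app n a)).app m _ = _
  refine congrArg _ (geomProd.ext ?_ rfl)
  exact FreeSimplex.taut_map w.1.1

lemma uncurry_injective : Function.Injective (uncurry : (A ⟶ mapSpace K Y) → _) := fun f g h => by
  rw [← curry_uncurry f, h, curry_uncurry]

lemma curry_injective : Function.Injective (curry : (geomProd A K ⟶ Y) → _) := fun f g h => by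
  rw [← uncurry_curry f, h, uncurry_curry]

lemma uncurry_comp (g : A' ⟶ A) (f : A ⟶ mapSpace K Y) :
    uncurry (g ≫ f) = geomProdMap g (𝟙 K) ≫ uncurry f := rfl

lemma curry_comp (g : A' ⟶ A) (h : geomProd A K ⟶ Y) :
    curry (geomProdMap g (𝟙 K) ≫ h) = g ≫ curry h :=
  uncurry_injective (by rw [uncurry_curry, uncurry_comp, uncurry_curry])

lemma uncurry_post (f : A ⟶ mapSpace K X) (p : X ⟶ Y) :
    uncurry (f ≫ mapSpacePost K p) = uncurry f ≫ p := rfl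

/-! ### Products with the empty semisimplicial set and with a coproduct -/

/-- The empty subobject. -/
noncomputable abbrev emptyι (B : SemiSSet.{u}) : (⊥ : Subfunctor B).toFunctor ⟶ B :=
  (⊥ : Subfunctor B).ι

lemma hom_ext_of_isEmpty (h : ∀ n, IsEmpty (A.obj n)) (f g : A ⟶ X) : f = g := by
  ext n a
  exact (h n).elim a

lemma exists_hom_of_isEmpty (h : ∀ n, IsEmpty (A.obj n)) (X : SemiSSet.{u}) :
    Nonempty (A ⟶ X) :=
  ⟨{ app n := ↾fun a => (h n).elim a
     naturality n m f := by
      ext a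
      exact (h n).elim a }⟩

lemma isEmpty_geomProd_empty (L B : SemiSSet.{u}) (n) :
    IsEmpty ((geomProd L (⊥ : Subfunctor B).toFunctor).obj n) :=
  ⟨fun z => z.1.2.elt.2⟩

/-- For A empty, the pushout product with A → B is just j ⊗ B, so the data on L ⊗ A and all
compatibilities with it are vacuous. -/
lemma PushoutProductLifting.exists_lift {j : K ⟶ L} {p : X ⟶ Y}
    (h : PushoutProductLifting j (emptyι B) p) (f : geomProd K B ⟶ X) (t : geomProd L B ⟶ Y)
    (hf : f ≫ p = geomProdMap j (𝟙 B) ≫ t) :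
    ∃ l : geomProd L B ⟶ X, geomProdMap j (𝟙 B) ≫ l = f ∧ l ≫ p = t := by
  obtain ⟨g⟩ := exists_hom_of_isEmpty (isEmpty_geomProd_empty L B) X
  obtain ⟨l, h₁, -, h₃⟩ := h f g t (hom_ext_of_isEmpty (isEmpty_geomProd_empty _ B) _ _) hf
    (hom_ext_of_isEmpty (isEmpty_geomProd_empty _ B) _ _)
  exact ⟨l, h₁, h₃⟩

/-! ### Fibrations -/

lemma fibrations_iff (p : X ⟶ Y) :
    fibrations p ↔ ∀ (n : ℕ) (k : Fin (n + 2)), HasLiftingProperty (horn.{u} (n + 1) k).ι p := by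
  constructor
  · intro h n k
    refine h _ ?_
    rw [hornInclusions, MorphismProperty.iSup_iff]
    exact ⟨n, ⟨k⟩⟩
  · intro h A B i hi
    rw [hornInclusions, MorphismProperty.iSup_iff] at hi
    obtain ⟨n, ⟨k⟩⟩ := hi
    exact h n k

instance : fibrations.{u}.IsMultiplicative :=
  inferInstanceAs hornInclusions.{u}.rlp.IsMultiplicative

instance : fibrations.{u}.IsStableUnderBaseChange :=
  inferInstanceAs hornInclusions.{u}.rlp.IsStableUnderBaseChange

instance : fibrations.{u}.RespectsIso :=
  MorphismProperty.RespectsIso.mk _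
    (fun e _ hf => fibrations.comp_mem _ _ (MorphismProperty.rlp_of_isIso _ e.hom) hf)
    (fun e _ hf => fibrations.comp_mem _ _ hf (MorphismProperty.rlp_of_isIso _ e.hom))

/-- By adjunction, this is lifting p against Λⁿ_k ⊗ B → Δⁿ ⊗ B. -/
lemma fibrations_mapSpacePost (B : SemiSSet.{u}) {p : X ⟶ Y} (hp : fibrations p) :
    fibrations (mapSpacePost B p) := by
  rw [fibrations_iff]
  refine fun n k => ⟨fun {f g} sq => ?_⟩
  obtain ⟨l, h₁, h₂⟩ := (pushoutProductLifting_horn k (emptyι B) hp).exists_lift (uncurry f)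
    (uncurry g) (by rw [← uncurry_post, sq.w, uncurry_comp])
  refine ⟨⟨curry l, ?_, ?_⟩⟩
  · exact uncurry_injective (by rw [uncurry_comp, uncurry_curry, h₁])
  · exact uncurry_injective (by rw [uncurry_post, uncurry_curry, h₂])

lemma isFibrant_iff {T : SemiSSet.{u}} (hT : IsTerminal T) (X : SemiSSet.{u}) :
    IsFibrant X ↔ fibrations (hT.from X) := by
  have : terminal.from X ≫ (terminalIsTerminal.uniqueUpToIso hT).hom = hT.from X := hT.hom_ext _ _
  rw [IsFibrant, ← this]
  exact (MorphismProperty.cancel_right_of_respectsIso fibrations _ _).symm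

lemma IsFibrant.of_fibrations {p : X ⟶ Y} (hp : fibrations p) (hY : IsFibrant Y) :
    IsFibrant X := by
  have : terminal.from X = p ≫ terminal.from Y := terminal.hom_ext _ _
  rw [IsFibrant, this]
  exact fibrations.comp_mem _ _ hp hY

/-- The mapping space into a terminal object is terminal. -/
noncomputable def isTerminalMapSpace (K : SemiSSet.{u}) :
    IsTerminal (mapSpace K (⊤_ SemiSSet.{u})) :=
  IsTerminal.ofUniqueHom (fun _ => curry (terminal.from _))
    fun _ _ => uncurry_injective (terminal.hom_ext _ _)

lemma isFibrant_mapSpace (K : SemiSSet.{u}) (hY : IsFibrant Y) : IsFibrant (mapSpace K Y) := by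
  rw [isFibrant_iff (isTerminalMapSpace K)]
  rw [show (isTerminalMapSpace K).from _ = mapSpacePost K (terminal.from Y) from
    (isTerminalMapSpace K).hom_ext _ _]
  exact fibrations_mapSpacePost K hY

/-! ### Endpoints and the unit -/

/-- The map `[0] ⟶ [1]` selecting a vertex. -/
def vertexMap (ε : Fin 2) : (⦋0⦌ₛ : SemiSimplexCategory) ⟶ ⦋1⦌ₛ :=
  SemiSimplexCategory.homEquiv.symm
    (OrderEmbedding.ofStrictMono (fun _ : Fin 1 => ε) (Subsingleton.strictMono _) :
      Fin 1 ↪o Fin 2)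

lemma endpoint_eq (ε : Fin 2) : endpoint.{u} ε = uliftYoneda.{u}.map (vertexMap ε) := rfl

lemma range_vertexMap (ε : Fin 2) :
    Set.range (SemiSimplexCategory.homEquiv (vertexMap ε)) = {ε} := by
  ext x
  constructor
  · rintro ⟨_, rfl⟩
    rfl
  · rintro rfl
    exact ⟨0, rfl⟩

lemma memHorn_vertexMap (ε : Fin 2) : MemHorn ε (vertexMap ε) := by
  rw [MemHorn, range_vertexMap, Set.union_self]
  intro h
  have : ε + 1 ∈ ({ε} : Set (Fin 2)) := h ▸ Set.mem_univ _
  fin_cases ε <;> simp at this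

lemma vertexMap_eq_coface (ε : Fin 2) : vertexMap ε = coface ε.rev := by
  apply hom_ext_of_range
  rw [range_vertexMap, range_coface]
  ext x
  fin_cases ε <;> fin_cases x <;> simp

lemma coface_eq_vertexMap (ε : Fin 2) : coface (n := 0) ε = vertexMap ε.rev := by
  rw [vertexMap_eq_coface, Fin.rev_rev]

instance (m : SemiSimplexCategory) : Subsingleton (m ⟶ ⦋0⦌ₛ) :=
  ⟨fun f g => by
    apply SemiSimplexCategory.hom_ext
    apply DFunLike.ext
    exact fun x => Subsingleton.elim (α := Fin 1) _ _⟩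

instance mono_endpoint (ε : Fin 2) : Mono (endpoint.{u} ε) := by
  have : ∀ n, Mono ((endpoint.{u} ε).app n) := fun n => by
    rw [mono_iff_injective]
    rintro ⟨x⟩ ⟨y⟩ _
    exact congrArg ULift.up (Subsingleton.elim (α := n.unop ⟶ ⦋0⦌ₛ) x y)
  exact NatTrans.mono_of_mono_app _

lemma range_endpoint_le (ε : Fin 2) : Subfunctor.range (endpoint.{u} ε) ≤ horn.{u} 1 ε := by
  rintro n _ ⟨⟨s⟩, rfl⟩
  have e : (ULift.down ((endpoint.{u} ε).app n (ULift.up s)) : n.unop ⟶ ⦋1⦌ₛ) =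
    (s : n.unop ⟶ ⦋0⦌ₛ) ≫ vertexMap ε := by simp [endpoint_eq]
  have h := (memHorn_vertexMap ε).precomp (s : n.unop ⟶ ⦋0⦌ₛ)
  rw [← e] at h
  exact h

/-- The point as a horn of the interval. -/
def toHornOne (ε : Fin 2) : simplex.{u} 0 ⟶ (horn.{u} 1 ε).toFunctor :=
  Subfunctor.lift (endpoint.{u} ε) (range_endpoint_le ε)

lemma toHornOne_ι (ε : Fin 2) : toHornOne.{u} ε ≫ (horn.{u} 1 ε).ι = endpoint ε := rfl

instance isIso_toHornOne (ε : Fin 2) : IsIso (toHornOne.{u} ε) := by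
  have : Mono (toHornOne.{u} ε) := by
    have : Mono (toHornOne.{u} ε ≫ (horn.{u} 1 ε).ι) := by
      rw [toHornOne_ι]
      infer_instance
    exact mono_of_mono _ (horn.{u} 1 ε).ι
  refine @NatIso.isIso_of_isIso_app _ _ _ _ _ _ _ fun n => ?_
  rw [isIso_iff_bijective]
  refine ⟨(mono_iff_injective _).1 inferInstance, ?_⟩
  rintro ⟨⟨g⟩, hg⟩
  obtain ⟨j, hj, a, ha⟩ := MemHorn.exists_coface (show MemHorn ε (g : n.unop ⟶ ⦋1⦌ₛ) from hg)
  refine ⟨ULift.up a, Subtype.ext (congrArg ULift.up ?_)⟩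
  change (ULift.down ((endpoint.{u} ε).app n (ULift.up a)) : n.unop ⟶ ⦋1⦌ₛ) = g
  rw [← ha, coface_eq_vertexMap, show j.rev = ε by revert hj; fin_cases j <;> fin_cases ε <;> simp]
  simp [endpoint_eq]

lemma pushoutProductLifting_endpoint (ε : Fin 2) (i : A ⟶ B) [Mono i] {p : X ⟶ Y}
    (hp : fibrations p) : PushoutProductLifting (endpoint.{u} ε) i p :=
  (pushoutProductLifting_horn ε i hp).of_iso (asIso (toHornOne ε))

instance subsingleton_freeSimplex {S : SimplexCategory} :
    Subsingleton (FreeSimplex (simplex.{u} 0) S) :=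
  ⟨fun _ _ => FreeSimplex.toHom_injective (Subsingleton.elim (α := S ⟶ ⦋0⦌) _ _)⟩

lemma FreeSimplex.exists_eq_nondegenerate {n : SemiSimplexCategoryᵒᵖ}
    (z : FreeSimplex A (toSimplexCategory.obj n.unop)) (h : Mono z.proj) :
    ∃ x : A.obj n, nondegenerate x = z := by
  obtain ⟨⟨c⟩, p, hp, e⟩ := z
  obtain ⟨⟨n⟩⟩ := n
  dsimp only at h
  obtain rfl : n = c := le_antisymm (@SimplexCategory.le_of_mono n c p h)
    (@SimplexCategory.le_of_epi n c p hp)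
  obtain rfl := @SimplexCategory.eq_id_of_mono _ p h
  exact ⟨e, rfl⟩

lemma FreeSimplex.nondegenerate_injective {n : SemiSimplexCategoryᵒᵖ} :
    Function.Injective (nondegenerate : A.obj n → _) := by
  intro x y h
  simpa [nondegenerate] using h

/-- A map to [0] separates nothing, so joint monicity makes the second projection monic as well as
epic, hence the identity. -/
instance isIso_toUnitProd (X : SemiSSet.{u}) : IsIso (toUnitProd X) := by
  refine @NatIso.isIso_of_isIso_app _ _ _ _ _ _ _ fun n => ?_
  rw [isIso_iff_bijective]
  constructor
  · intro x y h
    exact FreeSimplex.nondegenerate_injective (congrArg (fun z => z.1.2) h)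
  · intro z
    have : Mono z.1.2.proj := ⟨fun {T} s t h => by
      refine z.2 s t ?_ h
      have : Subsingleton (T ⟶ ⦋0⦌) := inferInstance
      have h₁ := (FreeSimplex.jointlyMono_toHom_iff z.1.1 z.1.2.proj).2 z.2 s t
        (Subsingleton.elim (α := T ⟶ ⦋0⦌) _ _) h
      rw [h₁]⟩
    obtain ⟨x, hx⟩ := FreeSimplex.exists_eq_nondegenerate z.1.2 this
    exact ⟨x, geomProd.ext (Subsingleton.elim _ _) hx⟩

lemma toUnitProd_naturality (f : X ⟶ Y) :
    f ≫ toUnitProd Y = toUnitProd X ≫ geomProdMap (𝟙 _) f := rfl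

lemma toUnitProd_naturality_assoc (f : X ⟶ Y) (h : geomProd (simplex.{u} 0) Y ⟶ Z) :
    f ≫ toUnitProd Y ≫ h = toUnitProd X ≫ geomProdMap (𝟙 _) f ≫ h := by
  rw [← Category.assoc, toUnitProd_naturality, Category.assoc]

end SemiSSet

namespace SemiSSet

variable {A B P Q X Y Z : SemiSSet.{u}}

/-! ### Filling horns given by their faces -/

/-- The `i`-th face of a simplex. -/
def face {n : ℕ} (i : Fin (n + 2)) (x : P.obj (op ⦋n + 1⦌ₛ)) : P.obj (op ⦋n⦌ₛ) :=
  P.map (coface i).op x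

lemma face_app (f : P ⟶ Q) {n : ℕ} (i : Fin (n + 2)) (x : P.obj (op ⦋n + 1⦌ₛ)) :
    face i (f.app _ x) = f.app _ (face i x) :=
  (NatTrans.naturality_apply f _ _).symm

lemma coface_comp_coface {n : ℕ} {i j : Fin (n + 2)} (h : i ≤ j) :
    coface i ≫ coface j.succ = coface j ≫ coface i.castSucc := by
  apply SemiSimplexCategory.toSimplexCategory.map_injective
  simp only [Functor.map_comp, toSimplexCategory_map_coface]
  exact SimplexCategory.δ_comp_δ h

lemma face_face {n : ℕ} {i j : Fin (n + 2)} (h : i ≤ j) (x : P.obj (op ⦋n + 1 + 1⦌ₛ)) :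
    face i (face j.succ x) = face j (face i.castSucc x) := by
  rw [face, face, face, face, ← Functor.map_comp_apply, ← Functor.map_comp_apply, ← op_comp,
    ← op_comp, coface_comp_coface h]

lemma exists_filler_of_compatible {p : P ⟶ Q} (hp : fibrations p) {n : ℕ} (k : Fin (n + 2))
    (y : Q.obj (op ⦋n + 1⦌ₛ)) (x : Fin (n + 2) → P.obj (op ⦋n⦌ₛ))
    (hx : ∀ i j, i < j → i ≠ k → j ≠ k → ∀ (m : SemiSimplexCategory) (a b : m ⟶ ⦋n⦌ₛ),
      a ≫ coface i = b ≫ coface j → P.map a.op (x i) = P.map b.op (x j))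
    (hy : ∀ j ≠ k, p.app _ (x j) = face j y) :
    ∃ z, p.app _ z = y ∧ ∀ j ≠ k, face j z = x j := by
  let R : ∀ m, (simplex.{u} (n + 1)).obj m → P.obj m → Prop := fun m g e =>
    ∃ j ≠ k, ∃ a : m.unop ⟶ ⦋n⦌ₛ, ULift.down g = a ≫ coface j ∧ e = P.map a.op (x j)
  have hR : IsPartialLift (ofElt y) p R := by
    refine ⟨?_, ?_, ?_⟩
    · rintro m m' f g e ⟨j, hj, a, h, rfl⟩
      refine ⟨j, hj, f.unop ≫ a, ?_, by simp⟩
      have : (ULift.down ((simplex.{u} (n + 1)).map f g) : m'.unop ⟶ ⦋n + 1⦌ₛ) =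
        f.unop ≫ ULift.down g := by simp
      rw [this, h, Category.assoc]
    · rintro m g e e' ⟨j, hj, a, h, rfl⟩ ⟨j', hj', a', h', rfl⟩
      have heq := h.symm.trans h'
      obtain hlt | rfl | hlt := lt_trichotomy j j'
      · exact hx j j' hlt hj hj' _ a a' heq
      · rw [(cancel_mono _).1 heq]
      · exact (hx j' j hlt hj' hj _ a' a heq.symm).symm
    · rintro m ⟨g⟩ e ⟨j, hj, a, h, rfl⟩
      dsimp only at h
      subst h
      rw [NatTrans.naturality_apply, hy j hj, face, ← Functor.map_comp_apply]
      rfl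
  obtain ⟨e, he, he'⟩ := hR.exists_filler hp k (ULift.up (𝟙 _)) (fun f hf => by
    obtain ⟨j, hj, a, rfl⟩ := hf.exists_coface
    exact ⟨_, j, hj, a, by simp, rfl⟩)
  have hid : ∀ {m} (f : m ⟶ ⦋n + 1⦌ₛ),
      (simplex.{u} (n + 1)).map f.op (ULift.up (𝟙 _)) = ULift.up f := fun f => by
    apply ULift.down_injective
    simp
  refine ⟨e, he.trans ?_, fun j hj => ?_⟩
  · exact ConcreteCategory.congr_hom (Q.map_id _) y
  · have h := he' (coface j) (memHorn_coface hj)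
    refine hR.unique h ⟨j, hj, 𝟙 _, ?_, by simp⟩
    rw [hid, Category.id_comp]

/-- Two distinct faces i < j of a simplex meet in a single common face, through which all shared
simplices factor. Compatibility therefore needs to be checked only there, where it is one simplicial
identity. -/
lemma exists_filler_of_faces {p : P ⟶ Q} (hp : fibrations p) {n : ℕ} (k : Fin (n + 3))
    (y : Q.obj (op ⦋n + 1 + 1⦌ₛ)) (x : Fin (n + 3) → P.obj (op ⦋n + 1⦌ₛ))
    (hx : ∀ i j : Fin (n + 2), i ≤ j → i.castSucc ≠ k → j.succ ≠ k →
      face i (x j.succ) = face j (x i.castSucc))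
    (hy : ∀ j ≠ k, p.app _ (x j) = face j y) :
    ∃ z, p.app _ z = y ∧ ∀ j ≠ k, face j z = x j := by
  refine exists_filler_of_compatible hp k y x (fun i' j' hij hi hj m a b hab => ?_) hy
  obtain ⟨i, rfl⟩ := Fin.exists_castSucc_eq.2 (Fin.ne_last_of_lt hij)
  obtain ⟨j, rfl⟩ := Fin.exists_succ_eq.2 (Fin.ne_zero_of_lt hij)
  have hle : i ≤ j := Fin.le_def.2 (Nat.lt_succ_iff.1 hij)
  obtain ⟨c, rfl⟩ : ∃ c, c ≫ coface i = b := by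
    apply exists_factor_of_range_subset
    rw [range_coface]
    rintro _ ⟨t, rfl⟩ (ht : _ = i)
    have h : SemiSimplexCategory.homEquiv (a ≫ coface i.castSucc) t =
        SemiSimplexCategory.homEquiv (b ≫ coface j.succ) t := by rw [hab]
    simp only [SemiSimplexCategory.homEquiv_comp, RelEmbedding.trans_apply, ht,
      homEquiv_coface, Fin.succAboveOrderEmb_apply] at h
    rw [Fin.succAbove_of_castSucc_lt j.succ i (Fin.castSucc_lt_succ_iff.2 hle)] at h
    exact Fin.succAbove_ne _ _ h
  have ha : a = c ≫ coface j := by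
    rw [← cancel_mono (coface i.castSucc), hab, Category.assoc, Category.assoc,
      coface_comp_coface hle]
  subst ha
  simpa [face] using congrArg (P.map c.op) (hx i j hle hi hj).symm

/-! ### Triangles in fibrant semisimplicial sets -/

/-- The edges `a`, `b` and `c` are the edges `01`, `12` and `02` of a triangle. -/
def IsTriangle (a b c : P.obj (op ⦋1⦌ₛ)) : Prop :=
  ∃ s : P.obj (op ⦋2⦌ₛ), face 2 s = a ∧ face 0 s = b ∧ face 1 s = c

namespace IsTriangle

variable {a b c : P.obj (op ⦋1⦌ₛ)}

lemma source_eq (h : IsTriangle a b c) : face 1 a = face 1 c := by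
  obtain ⟨s, rfl, rfl, rfl⟩ := h
  exact face_face (i := 1) (j := 1) le_rfl s

lemma middle_eq (h : IsTriangle a b c) : face 0 a = face 1 b := by
  obtain ⟨s, rfl, rfl, rfl⟩ := h
  exact face_face (i := 0) (j := 1) (Fin.zero_le _) s

lemma target_eq (h : IsTriangle a b c) : face 0 b = face 0 c := by
  obtain ⟨s, rfl, rfl, rfl⟩ := h
  exact (face_face (i := 0) (j := 0) le_rfl s).symm

lemma app (h : IsTriangle a b c) (f : P ⟶ Q) :
    IsTriangle (f.app _ a) (f.app _ b) (f.app _ c) := by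
  obtain ⟨s, rfl, rfl, rfl⟩ := h
  exact ⟨f.app _ s, face_app _ _ _, face_app _ _ _, face_app _ _ _⟩

end IsTriangle

instance subsingleton_terminal_obj (n : SemiSimplexCategoryᵒᵖ) :
    Subsingleton ((⊤_ SemiSSet.{u}).obj n) :=
  ⟨fun x y => uliftYonedaEquiv.symm.injective (terminal.hom_ext (ofElt x) (ofElt y))⟩

lemma nonempty_terminal_obj (n : SemiSimplexCategoryᵒᵖ) : Nonempty ((⊤_ SemiSSet.{u}).obj n) :=
  ⟨uliftYonedaEquiv (terminal.from (uliftYoneda.{u}.obj n.unop))⟩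

lemma IsFibrant.exists_filler (hP : IsFibrant P) {n : ℕ} (k : Fin (n + 3))
    (x : Fin (n + 3) → P.obj (op ⦋n + 1⦌ₛ))
    (hx : ∀ i j : Fin (n + 2), i ≤ j → i.castSucc ≠ k → j.succ ≠ k →
      face i (x j.succ) = face j (x i.castSucc)) :
    ∃ z : P.obj (op ⦋n + 1 + 1⦌ₛ), ∀ j ≠ k, face j z = x j := by
  obtain ⟨y⟩ := nonempty_terminal_obj.{u} (op ⦋n + 1 + 1⦌ₛ)
  obtain ⟨z, -, hz⟩ := exists_filler_of_faces hP k y x hx fun _ _ => Subsingleton.elim _ _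
  exact ⟨z, hz⟩

lemma IsFibrant.exists_edge (hP : IsFibrant P) (x : P.obj (op ⦋0⦌ₛ)) :
    ∃ a : P.obj (op ⦋1⦌ₛ), face 0 a = x := by
  obtain ⟨y⟩ := nonempty_terminal_obj.{u} (op ⦋1⦌ₛ)
  -- The horn is a single point, so no compatibility arises; k = 1 leaves face 0, the target,
  -- prescribed.
  obtain ⟨z, -, hz⟩ := exists_filler_of_compatible hP (n := 0) 1 y (fun _ => x)
    (fun i j hij hi hj => by fin_cases i <;> fin_cases j <;> simp at *)
    fun _ _ => Subsingleton.elim _ _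
  exact ⟨z, hz 0 (by simp)⟩

lemma IsFibrant.exists_isTriangle_left (hP : IsFibrant P) {b c : P.obj (op ⦋1⦌ₛ)}
    (h : face 0 b = face 0 c) : ∃ a, IsTriangle a b c := by
  -- The k-th entry of the list of faces is a dummy, here and in the fillings below.
  obtain ⟨z, hz⟩ := hP.exists_filler (n := 0) 2 ![b, c, c] (fun i j hij hi hj => by
    fin_cases i <;> fin_cases j <;> simp at *
    exact h.symm)
  exact ⟨_, z, rfl, hz 0 (by simp), hz 1 (by simp)⟩

lemma IsFibrant.exists_isTriangle_middle (hP : IsFibrant P) {a c : P.obj (op ⦋1⦌ₛ)}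
    (h : face 1 a = face 1 c) : ∃ b, IsTriangle a b c := by
  obtain ⟨z, hz⟩ := hP.exists_filler (n := 0) 0 ![c, c, a] (fun i j hij hi hj => by
    fin_cases i <;> fin_cases j <;> simp at *
    exact h)
  exact ⟨_, z, hz 2 (by simp), rfl, hz 1 (by simp)⟩

lemma IsFibrant.exists_isTriangle_right (hP : IsFibrant P) {a b : P.obj (op ⦋1⦌ₛ)}
    (h : face 0 a = face 1 b) : ∃ c, IsTriangle a b c := by
  obtain ⟨z, hz⟩ := hP.exists_filler (n := 0) 1 ![b, a, a] (fun i j hij hi hj => by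
    fin_cases i <;> fin_cases j <;> simp at *
    exact h)
  exact ⟨_, z, hz 2 (by simp), hz 0 (by simp), rfl⟩

lemma IsFibrant.isTriangle_face_zero (hP : IsFibrant P)
    {e₀₁ e₀₂ e₀₃ e₁₂ e₁₃ e₂₃ : P.obj (op ⦋1⦌ₛ)} (h₃ : IsTriangle e₀₁ e₁₂ e₀₂)
    (h₂ : IsTriangle e₀₁ e₁₃ e₀₃) (h₁ : IsTriangle e₀₂ e₂₃ e₀₃) : IsTriangle e₁₂ e₂₃ e₁₃ := by
  obtain ⟨s₁, h₁₂, h₁₀, h₁₁⟩ := h₁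
  obtain ⟨s₂, h₂₂, h₂₀, h₂₁⟩ := h₂
  obtain ⟨s₃, h₃₂, h₃₀, h₃₁⟩ := h₃
  obtain ⟨z, hz⟩ := hP.exists_filler (n := 1) 0 ![s₁, s₁, s₂, s₃] (fun i j hij hi hj => by
    fin_cases i <;> fin_cases j <;> simp at *
    · exact h₂₁.trans h₁₁.symm
    · exact h₃₁.trans h₁₂.symm
    · exact h₃₂.trans h₂₂.symm)
  refine ⟨face 0 z, ?_, ?_, ?_⟩
  · refine (face_face (i := 0) (j := 2) (Fin.zero_le _) z).symm.trans ?_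
    exact (congrArg (face 0) (hz 3 (by simp))).trans h₃₀
  · refine (face_face (i := 0) (j := 0) (Fin.zero_le _) z).symm.trans ?_
    exact (congrArg (face 0) (hz 1 (by simp))).trans h₁₀
  · refine (face_face (i := 0) (j := 1) (Fin.zero_le _) z).symm.trans ?_
    exact (congrArg (face 0) (hz 2 (by simp))).trans h₂₀

lemma IsFibrant.isTriangle_face_one (hP : IsFibrant P)
    {e₀₁ e₀₂ e₀₃ e₁₂ e₁₃ e₂₃ : P.obj (op ⦋1⦌ₛ)} (h₃ : IsTriangle e₀₁ e₁₂ e₀₂)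
    (h₂ : IsTriangle e₀₁ e₁₃ e₀₃) (h₀ : IsTriangle e₁₂ e₂₃ e₁₃) : IsTriangle e₀₂ e₂₃ e₀₃ := by
  obtain ⟨s₀, h₀₂, h₀₀, h₀₁⟩ := h₀
  obtain ⟨s₂, h₂₂, h₂₀, h₂₁⟩ := h₂
  obtain ⟨s₃, h₃₂, h₃₀, h₃₁⟩ := h₃
  obtain ⟨z, hz⟩ := hP.exists_filler (n := 1) 1 ![s₀, s₀, s₂, s₃] (fun i j hij hi hj => by
    fin_cases i <;> fin_cases j <;> simp at *
    · exact h₂₀.trans h₀₁.symm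
    · exact h₃₀.trans h₀₂.symm
    · exact h₃₂.trans h₂₂.symm)
  refine ⟨face 1 z, ?_, ?_, ?_⟩
  · refine (face_face (i := 1) (j := 2) (by simp) z).symm.trans ?_
    exact (congrArg (face 1) (hz 3 (by simp))).trans h₃₁
  · refine (face_face (i := 0) (j := 0) (Fin.zero_le _) z).trans ?_
    exact (congrArg (face 0) (hz 0 (by simp))).trans h₀₀
  · refine (face_face (i := 1) (j := 1) le_rfl z).symm.trans ?_
    exact (congrArg (face 1) (hz 2 (by simp))).trans h₂₁

/-- Every vertex of a fibrant semisimplicial set has an idempotent loop. -/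
lemma IsFibrant.exists_idempotent (hP : IsFibrant P) (x : P.obj (op ⦋0⦌ₛ)) :
    ∃ e, face 1 e = x ∧ face 0 e = x ∧ IsTriangle e e e := by
  obtain ⟨a, ha⟩ := hP.exists_edge x
  -- The loop e satisfies "a followed by e is a". In a tetrahedron whose three edges at vertex 0 are
  -- all a, filling the face opposite to that vertex gives the triangle on e, e, e.
  obtain ⟨e, he⟩ := hP.exists_isTriangle_middle (a := a) (c := a) rfl
  exact ⟨e, he.middle_eq.symm.trans ha, he.target_eq.trans ha, hP.isTriangle_face_zero he he he⟩

/-- Write q as some w followed by e. Then q followed by e is w followed by e twice, which is q again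
by associativity and idempotence. -/
lemma IsFibrant.isTriangle_idempotent (hP : IsFibrant P) {q e : P.obj (op ⦋1⦌ₛ)}
    (he : IsTriangle e e e) (h : face 0 q = face 1 e) : IsTriangle q e q := by
  obtain ⟨w, hw⟩ := hP.exists_isTriangle_left (b := e) (c := q) (he.middle_eq.trans h.symm)
  exact hP.isTriangle_face_one hw hw he

/-! ### Homotopies between maps to fibrant semisimplicial sets -/

/-- The coface omitting vertex 1 selects vertex 0, so face 1 of an edge is its source. -/
lemma atEndpoint_zero (h : geomProd (simplex.{u} 1) X ⟶ Y) :
    atEndpoint h 0 = toUnitProd X ≫ mapSpace.toHom (face 1 (P := mapSpace X Y) h) := by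
  change _ = toUnitProd X ≫ geomProdMap (uliftYoneda.{u}.map (coface 1)) (𝟙 X) ≫ h
  rw [coface_eq_vertexMap]
  rfl

lemma atEndpoint_one (h : geomProd (simplex.{u} 1) X ⟶ Y) :
    atEndpoint h 1 = toUnitProd X ≫ mapSpace.toHom (face 0 (P := mapSpace X Y) h) := by
  change _ = toUnitProd X ≫ geomProdMap (uliftYoneda.{u}.map (coface 0)) (𝟙 X) ≫ h
  rw [coface_eq_vertexMap]
  rfl

/-- The vertex of the mapping space corresponding to a map. -/
noncomputable def mapSpace.vertex (f : X ⟶ Y) : (mapSpace X Y).obj (op ⦋0⦌ₛ) :=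
  (inv (toUnitProd X) ≫ f :)

lemma atEndpoint_zero_eq_iff (h : geomProd (simplex.{u} 1) X ⟶ Y) (f : X ⟶ Y) :
    atEndpoint h 0 = f ↔ face 1 (P := mapSpace X Y) h = mapSpace.vertex f := by
  rw [atEndpoint_zero]
  exact (IsIso.eq_inv_comp (toUnitProd X)).symm

lemma atEndpoint_one_eq_iff (h : geomProd (simplex.{u} 1) X ⟶ Y) (f : X ⟶ Y) :
    atEndpoint h 1 = f ↔ face 0 (P := mapSpace X Y) h = mapSpace.vertex f := by
  rw [atEndpoint_one]
  exact (IsIso.eq_inv_comp (toUnitProd X)).symm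

lemma atEndpoint_comp (h : geomProd (simplex.{u} 1) X ⟶ Y) (p : Y ⟶ Z) (ε : Fin 2) :
    atEndpoint (h ≫ p) ε = atEndpoint h ε ≫ p := rfl

lemma atEndpoint_map_comp (g : X ⟶ Y) (h : geomProd (simplex.{u} 1) Y ⟶ Z) (ε : Fin 2) :
    atEndpoint (geomProdMap (𝟙 _) g ≫ h) ε = g ≫ atEndpoint h ε := rfl

lemma homotopic_iff (f₀ f₁ : X ⟶ Y) : Homotopic f₀ f₁ ↔
    ∃ h : (mapSpace X Y).obj (op ⦋1⦌ₛ), face 1 h = mapSpace.vertex f₀ ∧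
      face 0 h = mapSpace.vertex f₁ := by
  constructor
  · rintro ⟨h, h₀, h₁⟩
    exact ⟨h, (atEndpoint_zero_eq_iff h f₀).1 h₀, (atEndpoint_one_eq_iff h f₁).1 h₁⟩
  · rintro ⟨h, h₀, h₁⟩
    exact ⟨h, (atEndpoint_zero_eq_iff h f₀).2 h₀, (atEndpoint_one_eq_iff h f₁).2 h₁⟩

/-- An idempotent loop at f stands in for the unavailable constant homotopy. -/
lemma Homotopic.refl (hY : IsFibrant Y) (f : X ⟶ Y) : Homotopic f f := by
  rw [homotopic_iff]
  obtain ⟨e, h₁, h₀, -⟩ := (isFibrant_mapSpace X hY).exists_idempotent (mapSpace.vertex f)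
  exact ⟨e, h₁, h₀⟩

lemma Homotopic.symm (hY : IsFibrant Y) {f₀ f₁ : X ⟶ Y} (h : Homotopic f₀ f₁) :
    Homotopic f₁ f₀ := by
  obtain ⟨r, hr₁, hr₀⟩ := (homotopic_iff _ _).1 (Homotopic.refl hY f₀)
  rw [homotopic_iff] at h ⊢
  obtain ⟨q, h₁, h₀⟩ := h
  -- In a triangle whose edge 01 is the given homotopy and whose edge 02 is a loop at f₀, the edge
  -- 12 is the reversed homotopy.
  obtain ⟨b, hb⟩ := (isFibrant_mapSpace X hY).exists_isTriangle_middle (h₁.trans hr₁.symm)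
  exact ⟨b, hb.middle_eq.symm.trans h₀, hb.target_eq.trans hr₀⟩

lemma Homotopic.trans (hY : IsFibrant Y) {f₀ f₁ f₂ : X ⟶ Y} (h : Homotopic f₀ f₁)
    (h' : Homotopic f₁ f₂) : Homotopic f₀ f₂ := by
  rw [homotopic_iff] at h h' ⊢
  obtain ⟨a, h₁, h₀⟩ := h
  obtain ⟨b, h₁', h₀'⟩ := h'
  obtain ⟨c, hc⟩ := (isFibrant_mapSpace X hY).exists_isTriangle_right (h₀.trans h₁'.symm)
  exact ⟨c, hc.source_eq.symm.trans h₁, hc.target_eq.symm.trans h₀'⟩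

lemma Homotopic.precomp {f₀ f₁ : Y ⟶ Z} (h : Homotopic f₀ f₁) (g : X ⟶ Y) :
    Homotopic (g ≫ f₀) (g ≫ f₁) := by
  obtain ⟨h, rfl, rfl⟩ := h
  exact ⟨geomProdMap (𝟙 _) g ≫ h, rfl, rfl⟩

lemma Homotopic.postcomp {f₀ f₁ : X ⟶ Y} (h : Homotopic f₀ f₁) (g : Y ⟶ Z) :
    Homotopic (f₀ ≫ g) (f₁ ≫ g) := by
  obtain ⟨h, rfl, rfl⟩ := h
  exact ⟨h ≫ g, rfl, rfl⟩

end SemiSSet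

namespace SemiSSet

variable {A B K P Q X Y Z : SemiSSet.{u}}

/-! ### Trivial fibrations -/

/-- Relative homotopy lifting. -/
lemma exists_homotopy_lift_extension {p : X ⟶ Y} (hp : fibrations p) (i : A ⟶ B) [Mono i]
    (ε : Fin 2) (b : B ⟶ X) (v : geomProd (simplex.{u} 1) A ⟶ X)
    (t : geomProd (simplex.{u} 1) B ⟶ Y) (h₁ : atEndpoint v ε = i ≫ b)
    (h₂ : b ≫ p = atEndpoint t ε) (h₃ : v ≫ p = geomProdMap (𝟙 _) i ≫ t) :
    ∃ l : geomProd (simplex.{u} 1) B ⟶ X,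
      atEndpoint l ε = b ∧ geomProdMap (𝟙 _) i ≫ l = v ∧ l ≫ p = t := by
  obtain ⟨l, hl₁, hl₂, hl₃⟩ := pushoutProductLifting_endpoint ε i hp
    (inv (toUnitProd B) ≫ b) v t
    (by
      rw [← cancel_epi (toUnitProd A), ← toUnitProd_naturality_assoc, IsIso.hom_inv_id_assoc, ← h₁]
      rfl)
    (by
      rw [← cancel_epi (toUnitProd B), Category.assoc, IsIso.hom_inv_id_assoc, h₂]
      rfl) h₃
  refine ⟨l, ?_, hl₂, hl₃⟩
  rw [atEndpoint, hl₁, IsIso.hom_inv_id_assoc]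

lemma isEmpty_empty (B : SemiSSet.{u}) (n) : IsEmpty ((⊥ : Subfunctor B).toFunctor.obj n) :=
  ⟨fun x => x.2⟩

lemma exists_homotopy_lift {p : X ⟶ Y} (hp : fibrations p) (ε : Fin 2) (b : B ⟶ X)
    (t : geomProd (simplex.{u} 1) B ⟶ Y) (h : b ≫ p = atEndpoint t ε) :
    ∃ l : geomProd (simplex.{u} 1) B ⟶ X, atEndpoint l ε = b ∧ l ≫ p = t := by
  obtain ⟨v⟩ := exists_hom_of_isEmpty (isEmpty_geomProd_empty (simplex.{u} 1) B) X
  obtain ⟨l, h₁, -, h₃⟩ := exists_homotopy_lift_extension hp (emptyι B) ε b v t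
    (hom_ext_of_isEmpty (isEmpty_empty B) _ _) h
    (hom_ext_of_isEmpty (isEmpty_geomProd_empty _ B) _ _)
  exact ⟨l, h₁, h₃⟩

/-- A fibration between fibrant objects that is a homotopy equivalence has a section such that the
composite with it is homotopic to the identity by a homotopy lying over a given idempotent
homotopy. -/
lemma exists_section_of_homotopyEquivalence (hX : IsFibrant X) (hY : IsFibrant Y) {p : X ⟶ Y}
    (hp : fibrations p) (hW : homotopyEquivalences p) {c : (mapSpace Y Y).obj (op ⦋1⦌ₛ)}
    (hc : face 0 c = mapSpace.vertex (𝟙 Y)) (hccc : IsTriangle c c c) :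
    ∃ (s : Y ⟶ X) (k : geomProd (simplex.{u} 1) X ⟶ X), s ≫ p = 𝟙 Y ∧ atEndpoint k 0 = p ≫ s ∧
      atEndpoint k 1 = 𝟙 X ∧ k ≫ p = geomProdMap (𝟙 _) p ≫ mapSpace.toHom c := by
  obtain ⟨g, hg, h, h₀, h₁⟩ := hW
  -- Lifting the homotopy from g followed by p to the identity deforms g into a strict section s.
  obtain ⟨H, H₀, H₁⟩ := exists_homotopy_lift hp 0 g h h₀.symm
  obtain ⟨s, hs⟩ : ∃ s, atEndpoint H 1 = s := ⟨_, rfl⟩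
  have hsp : s ≫ p = 𝟙 Y := by rw [← hs, ← atEndpoint_comp, H₁, h₁]
  have hgs : Homotopic g s := ⟨H, H₀, hs⟩
  obtain ⟨k, k₀, k₁⟩ := ((hgs.symm hX).precomp p).trans hX hg
  have hM := isFibrant_mapSpace X hY
  let e : (mapSpace X Y).obj (op ⦋1⦌ₛ) := (mapSpacePre p Y).app _ c
  let q : (mapSpace X Y).obj (op ⦋1⦌ₛ) := (mapSpacePost X p).app _ k
  have he : IsTriangle e e e := hccc.app _
  have hq : face 0 q = face 1 e := by
    have h₁ : face 0 q = mapSpace.vertex p := by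
      refine (atEndpoint_one_eq_iff (k ≫ p) p).1 ?_
      rw [atEndpoint_comp, k₁, Category.id_comp]
    have h₂ : face 0 e = mapSpace.vertex p := by
      refine (atEndpoint_one_eq_iff (geomProdMap (𝟙 _) p ≫ mapSpace.toHom c) p).1 ?_
      rw [atEndpoint_map_comp, (atEndpoint_one_eq_iff _ _).2 hc, Category.comp_id]
    rw [h₁, ← h₂, he.middle_eq]
  -- The homotopy k lies over an uncontrolled loop q at p. The triangle q, e, q in the base allows k
  -- to be corrected to a homotopy over e.
  obtain ⟨y, hy₂, hy₀, hy₁⟩ := hM.isTriangle_idempotent he hq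
  let k' : (mapSpace X X).obj (op ⦋1⦌ₛ) := k
  let k'' : (mapSpace X X).obj (op ⦋1⦌ₛ) := (k ≫ p ≫ s :)
  have hk' : face 1 k' = mapSpace.vertex (p ≫ s) := (atEndpoint_zero_eq_iff k _).1 k₀
  have hk'' : face 1 k'' = mapSpace.vertex (p ≫ s) := by
    refine (atEndpoint_zero_eq_iff (k ≫ p ≫ s) (p ≫ s)).1 ?_
    rw [atEndpoint_comp, k₀, Category.assoc, reassoc_of% hsp]
  -- Both k and its composite with p and s lie over q and start at p ≫ s. The remaining edge of the
  -- filler runs from p ≫ s to the identity and lies over e.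
  obtain ⟨z, hz, hzf⟩ := exists_filler_of_faces (fibrations_mapSpacePost X hp) (n := 0) 0 y
    ![k', k', k''] (fun i j hij hi hj => by
      fin_cases i <;> fin_cases j <;> simp at *
      exact hk''.trans hk'.symm) (fun j hj => by
      fin_cases j
      · simp at hj
      · exact hy₁.symm
      · refine Eq.trans ?_ hy₂.symm
        change (k ≫ p ≫ s) ≫ p = k ≫ p
        rw [Category.assoc, Category.assoc, hsp, Category.comp_id])
  have hz₁ : face 1 z = k' := hzf 1 (by simp)
  have hz₂ : face 2 z = k'' := hzf 2 (by simp)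
  refine ⟨s, mapSpace.toHom (face 0 z), hsp, ?_, ?_, ?_⟩
  · rw [atEndpoint_zero_eq_iff]
    refine (face_face (i := 0) (j := 1) (Fin.zero_le _) z).symm.trans ?_
    refine (congrArg (face 0) hz₂).trans ?_
    refine (atEndpoint_one_eq_iff (k ≫ p ≫ s) (p ≫ s)).1 ?_
    rw [atEndpoint_comp, k₁, Category.id_comp]
  · rw [atEndpoint_one_eq_iff]
    refine (face_face (i := 0) (j := 0) (Fin.zero_le _) z).symm.trans ?_
    exact (congrArg (face 0) hz₁).trans ((atEndpoint_one_eq_iff k _).1 k₁)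
  · refine (face_app (mapSpacePost X p) 0 z).symm.trans ?_
    rw [hz, hy₀]
    rfl

/-- For a square from i to p with sides a and b, the map b ≫ s lies over b but restricts along i
only to a ≫ p ≫ s. The homotopy k moves this restriction to a; extended over B by relative homotopy
lifting, it ends at a diagonal. This diagonal still lies over b because the homotopy c underneath k
returns to the identity. -/
theorem rlp_monomorphisms_of_homotopyEquivalence (hX : IsFibrant X) (hY : IsFibrant Y) {p : X ⟶ Y}
    (hp : fibrations p) (hW : homotopyEquivalences p) :
    (MorphismProperty.monomorphisms SemiSSet.{u}).rlp p := by
  obtain ⟨c, hc₁, hc₀, hc⟩ := (isFibrant_mapSpace Y hY).exists_idempotent (mapSpace.vertex (𝟙 Y))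
  obtain ⟨s, k, hs, hk₀, hk₁, hkp⟩ := exists_section_of_homotopyEquivalence hX hY hp hW hc₀ hc
  intro A B i (hi : Mono i)
  refine ⟨fun {a b} sq => ?_⟩
  obtain ⟨l, hl₀, hl₁, hl₂⟩ := exists_homotopy_lift_extension hp i 0 (b ≫ s)
    (geomProdMap (𝟙 _) a ≫ k) (geomProdMap (𝟙 _) b ≫ mapSpace.toHom c)
    (by rw [atEndpoint_map_comp, hk₀, sq.w_assoc])
    (by rw [atEndpoint_map_comp, (atEndpoint_zero_eq_iff _ _).2 hc₁, Category.assoc, hs])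
    (by
      rw [Category.assoc, hkp, geomProdMap_comp_map_assoc, geomProdMap_comp_map_assoc, sq.w])
  refine ⟨⟨atEndpoint l 1, ?_, ?_⟩⟩
  · rw [← atEndpoint_map_comp, hl₁, atEndpoint_map_comp, hk₁, Category.comp_id]
  · rw [← atEndpoint_comp, hl₂, atEndpoint_map_comp, (atEndpoint_one_eq_iff _ _).2 hc₀,
      Category.comp_id]

lemma fibrations_of_rlp_monomorphisms {p : X ⟶ Y}
    (hp : (MorphismProperty.monomorphisms SemiSSet.{u}).rlp p) : fibrations p := by
  rw [fibrations_iff]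
  exact fun n k => hp _ (MorphismProperty.monomorphisms.infer_property _)

/-! ### The boundary of the interval -/

/-- The coproduct of two copies of a semisimplicial set. -/
def twoCopies (P : SemiSSet.{u}) : SemiSSet.{u} where
  obj n := Fin 2 × P.obj n
  map f := ↾fun z => (z.1, P.map f z.2)
  map_id n := by
    refine ConcreteCategory.hom_ext _ _ fun z => ?_
    exact Prod.ext rfl (ConcreteCategory.congr_hom (P.map_id n) z.2)
  map_comp f g := by
    refine ConcreteCategory.hom_ext _ _ fun z => ?_
    exact Prod.ext rfl (ConcreteCategory.congr_hom (P.map_comp f g) z.2)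

/-- A map from the coproduct of two copies of a semisimplicial set. -/
def twoCopiesDesc (f : Fin 2 → (P ⟶ Z)) : twoCopies P ⟶ Z where
  app n := ↾fun z => (f z.1).app n z.2
  naturality n m a := by
    refine ConcreteCategory.hom_ext _ _ fun z => ?_
    exact NatTrans.naturality_apply (f z.1) a z.2

/-- The coproduct of two points. -/
def twoPoints : SemiSSet.{u} := twoCopies (simplex.{u} 0)

/-- The inclusions of the two points. -/
def twoPoints.incl (ε : Fin 2) : simplex.{u} 0 ⟶ twoPoints.{u} where
  app n := ↾fun s => (ε, s)

/-- A map from the coproduct of two points. -/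
def twoPoints.desc (f : Fin 2 → (simplex.{u} 0 ⟶ Z)) : twoPoints.{u} ⟶ Z := twoCopiesDesc f

lemma twoPoints.incl_desc (f : Fin 2 → (simplex.{u} 0 ⟶ Z)) (ε : Fin 2) :
    incl ε ≫ desc f = f ε := rfl

lemma twoPoints.hom_ext {f g : twoPoints.{u} ⟶ Z} (h : ∀ ε, incl ε ≫ f = incl ε ≫ g) : f = g := by
  ext n ⟨ε, s⟩
  exact ConcreteCategory.congr_hom (NatTrans.congr_app (h ε) n) s

/-- The inclusion of the boundary of the interval. -/
def boundaryι : twoPoints.{u} ⟶ simplex.{u} 1 := twoPoints.desc endpoint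

instance mono_boundaryι : Mono boundaryι.{u} := by
  have : ∀ n, Mono (boundaryι.{u}.app n) := fun n => by
    rw [mono_iff_injective]
    rintro ⟨ε, ⟨s⟩⟩ ⟨ε', ⟨s'⟩⟩ h
    obtain rfl : s = s' := Subsingleton.elim (α := n.unop ⟶ ⦋0⦌ₛ) s s'
    have key : ∀ ε, (ULift.down (boundaryι.{u}.app n (ε, ULift.up s)) : n.unop ⟶ ⦋1⦌ₛ) =
        (s : n.unop ⟶ ⦋0⦌ₛ) ≫ vertexMap ε := fun ε => by
      change (ULift.down ((endpoint.{u} ε).app n (ULift.up s)) : n.unop ⟶ ⦋1⦌ₛ) = _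
      simp [endpoint_eq]
    have h' : (s : n.unop ⟶ ⦋0⦌ₛ) ≫ vertexMap ε = s ≫ vertexMap ε' := by
      rw [← key, ← key, h]
    have h'' := congrArg (fun f => SemiSimplexCategory.homEquiv f 0) h'
    obtain rfl : ε = ε' := h''
    rfl
  exact NatTrans.mono_of_mono_app _

lemma exists_hom_twoPoints (f : Fin 2 → (X ⟶ Z)) :
    ∃ F : geomProd twoPoints.{u} X ⟶ Z,
      ∀ ε, toUnitProd X ≫ geomProdMap (twoPoints.incl ε) (𝟙 X) ≫ F = f ε := by
  refine ⟨uncurry (twoPoints.desc fun ε => curry (inv (toUnitProd X) ≫ f ε)), fun ε => ?_⟩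
  rw [← uncurry_comp, twoPoints.incl_desc, uncurry_curry, IsIso.hom_inv_id_assoc]

lemma hom_ext_twoPoints {F G : geomProd twoPoints.{u} X ⟶ Z}
    (h : ∀ ε, toUnitProd X ≫ geomProdMap (twoPoints.incl ε) (𝟙 X) ≫ F =
      toUnitProd X ≫ geomProdMap (twoPoints.incl ε) (𝟙 X) ≫ G) : F = G := by
  apply curry_injective
  refine twoPoints.hom_ext fun ε => ?_
  rw [← curry_comp, ← curry_comp]
  exact congrArg curry ((cancel_epi _).1 (h ε))

/-- Lifting against ∅ → Y gives a section s, and lifting against ∂Δ¹ ⊗ X → Δ¹ ⊗ X over a homotopy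
from p to p joins p ≫ s to the identity. -/
theorem homotopyEquivalences_of_rlp_monomorphisms (hY : IsFibrant Y) {p : X ⟶ Y}
    (hp : (MorphismProperty.monomorphisms SemiSSet.{u}).rlp p) : homotopyEquivalences p := by
  obtain ⟨s, hs⟩ : ∃ s, s ≫ p = 𝟙 Y := by
    obtain ⟨f⟩ := exists_hom_of_isEmpty (A := (⊥ : Subfunctor Y).toFunctor)
      (isEmpty_empty Y) X
    have sq : CommSq f (emptyι Y) p (𝟙 Y) := ⟨hom_ext_of_isEmpty (isEmpty_empty Y) _ _⟩
    have := hp (emptyι Y) (MorphismProperty.monomorphisms.infer_property _)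
    exact ⟨sq.lift, sq.fac_right⟩
  refine ⟨s, ?_, hs ▸ Homotopic.refl hY _⟩
  obtain ⟨h, h₀, h₁⟩ := Homotopic.refl hY p
  obtain ⟨F, hF⟩ := exists_hom_twoPoints ![p ≫ s, 𝟙 X]
  have sq : CommSq F (geomProdMap boundaryι (𝟙 X)) p h := ⟨hom_ext_twoPoints fun ε => by
    rw [reassoc_of% hF]
    refine Eq.trans ?_ (show atEndpoint h ε = _ from rfl)
    fin_cases ε
    · refine Eq.trans ?_ h₀.symm
      simp [hs]
    · refine Eq.trans ?_ h₁.symm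
      simp⟩
  have := hp (geomProdMap boundaryι (𝟙 X)) (MorphismProperty.monomorphisms.infer_property _)
  have key : ∀ ε, atEndpoint sq.lift ε = (![p ≫ s, 𝟙 X] : Fin 2 → (X ⟶ X)) ε := fun ε => by
    rw [← hF]
    exact congrArg (fun G => toUnitProd X ≫ geomProdMap (twoPoints.incl ε) (𝟙 X) ≫ G) sq.fac_left
  exact ⟨sq.lift, key 0, key 1⟩

/-! ### Path objects -/

/-- The path object. -/
noncomputable abbrev pathObject (Y : SemiSSet.{u}) : SemiSSet.{u} := mapSpace (simplex.{u} 1) Y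

/-- The homotopy corresponding to a map to the path object. -/
noncomputable def ofPath (f : A ⟶ pathObject Y) : geomProd (simplex.{u} 1) A ⟶ Y :=
  geomProdSwap _ _ ≫ uncurry f

/-- The map to the path object corresponding to a homotopy. -/
noncomputable def toPath (h : geomProd (simplex.{u} 1) A ⟶ Y) : A ⟶ pathObject Y :=
  curry (geomProdSwap _ _ ≫ h)

@[simp]
lemma ofPath_toPath (h : geomProd (simplex.{u} 1) A ⟶ Y) : ofPath (toPath h) = h := by
  rw [ofPath, toPath, uncurry_curry, geomProdSwap_swap_assoc]

instance isIso_geomProdSwap (A B : SemiSSet.{u}) : IsIso (geomProdSwap A B) :=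
  ⟨geomProdSwap B A, rfl, rfl⟩

lemma ofPath_injective : Function.Injective (ofPath : (A ⟶ pathObject Y) → _) := fun _ _ h =>
  uncurry_injective ((cancel_epi (geomProdSwap (simplex.{u} 1) A)).1 h)

lemma ofPath_comp (g : A ⟶ B) (f : B ⟶ pathObject Y) :
    ofPath (g ≫ f) = geomProdMap (𝟙 _) g ≫ ofPath f := rfl

/-- The evaluation of paths at an endpoint. -/
noncomputable def pathEval (Y : SemiSSet.{u}) (ε : Fin 2) : pathObject Y ⟶ Y :=
  atEndpoint (ofPath (𝟙 _)) ε

lemma comp_pathEval (f : A ⟶ pathObject Y) (ε : Fin 2) :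
    f ≫ pathEval Y ε = atEndpoint (ofPath f) ε := by
  rw [pathEval, ← atEndpoint_map_comp, ← ofPath_comp, Category.comp_id]

/-- By adjunction, this is lifting Y → 1 against the pushout product of an endpoint inclusion with
i. -/
lemma rlp_monomorphisms_pathEval (hY : IsFibrant Y) (ε : Fin 2) :
    (MorphismProperty.monomorphisms SemiSSet.{u}).rlp (pathEval Y ε) := by
  intro A B i (hi : Mono i)
  refine ⟨fun {f b} sq => ?_⟩
  obtain ⟨l, h₁, h₂, -⟩ := exists_homotopy_lift_extension hY i ε b (ofPath f) (terminal.from _)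
    (by rw [← comp_pathEval, sq.w]) (terminal.hom_ext _ _) (terminal.hom_ext _ _)
  refine ⟨⟨toPath l, ofPath_injective ?_, ?_⟩⟩
  · rw [ofPath_comp, ofPath_toPath, h₂]
  · rw [comp_pathEval, ofPath_toPath, h₁]

/-- By adjunction and symmetry, this is lifting against the pushout product of ∂Δ¹ → Δ¹ with the
horn: the jointly evaluated map from paths to pairs of endpoints is a fibration. -/
lemma exists_path_lift (hY : IsFibrant Y) {n : ℕ} (k : Fin (n + 2))
    (f : (horn.{u} (n + 1) k).toFunctor ⟶ pathObject Y) (b : Fin 2 → (simplex.{u} (n + 1) ⟶ Y))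
    (h : ∀ ε, f ≫ pathEval Y ε = (horn.{u} (n + 1) k).ι ≫ b ε) :
    ∃ l, (horn.{u} (n + 1) k).ι ≫ l = f ∧ ∀ ε, l ≫ pathEval Y ε = b ε := by
  obtain ⟨F, hF⟩ := exists_hom_twoPoints b
  obtain ⟨l, h₁, h₂, -⟩ := (pushoutProductLifting_horn k boundaryι hY).symm F (ofPath f)
    (terminal.from _) (hom_ext_twoPoints fun ε => by
      refine Eq.trans ?_ ((h ε).symm.trans (comp_pathEval f ε))
      rw [← hF]
      rfl) (terminal.hom_ext _ _) (terminal.hom_ext _ _)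
  refine ⟨toPath l, ofPath_injective ?_, fun ε => ?_⟩
  · rw [ofPath_comp, ofPath_toPath, h₂]
  · rw [comp_pathEval, ofPath_toPath, ← hF, ← h₁]
    rfl

/-! ### The mapping path space factorization -/

/-- The middle object consists of a point x of X and a path starting at f x. Its projection π to X
is a pullback of a trivial fibration; the map i, a section of π, uses a self-homotopy of the
identity in place of constant paths. -/
theorem exists_factorization (hX : IsFibrant X) (hY : IsFibrant Y) (f : X ⟶ Y) :
    ∃ (Z : SemiSSet.{u}) (i : X ⟶ Z) (p : Z ⟶ Y), IsFibrant Z ∧ homotopyEquivalences i ∧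
      fibrations p ∧ i ≫ p = f := by
  obtain ⟨c, hc₀, hc₁⟩ := Homotopic.refl hY (𝟙 Y)
  let π : pullback f (pathEval Y 0) ⟶ X := pullback.fst _ _
  have hπ : (MorphismProperty.monomorphisms SemiSSet.{u}).rlp π :=
    MorphismProperty.pullback_fst _ _ (rlp_monomorphisms_pathEval hY 0)
  have hZ : IsFibrant (pullback f (pathEval Y 0)) :=
    IsFibrant.of_fibrations (fibrations_of_rlp_monomorphisms hπ) hX
  let i : X ⟶ pullback f (pathEval Y 0) := pullback.lift (𝟙 X) (f ≫ toPath c) (by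
    rw [Category.assoc, comp_pathEval, ofPath_toPath, hc₀, Category.comp_id, Category.id_comp])
  have hiπ : i ≫ π = 𝟙 X := pullback.lift_fst _ _ _
  refine ⟨_, i, pullback.snd _ _ ≫ pathEval Y 1, hZ, ⟨π, hiπ ▸ Homotopic.refl hX _, ?_⟩, ?_, ?_⟩
  -- Since i ≫ π is the identity, π ≫ i ∼ π ≫ i ≫ π ≫ g = π ≫ g ∼ 𝟙.
  · obtain ⟨g, hg, -⟩ := homotopyEquivalences_of_rlp_monomorphisms hX hπ
    have h := (hg.symm hZ).precomp (π ≫ i)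
    have e : (π ≫ i) ≫ π ≫ g = π ≫ g := by rw [Category.assoc, reassoc_of% hiπ]
    rw [e, Category.comp_id] at h
    exact h.trans hZ hg
  · rw [fibrations_iff]
    refine fun n k => ⟨fun {a b} sq => ?_⟩
    -- First the X-component of the horn is extended by fibrancy of X; then the path is extended
    -- with both endpoints prescribed.
    obtain ⟨x, hx⟩ : ∃ x : simplex.{u} (n + 1) ⟶ X, (horn.{u} (n + 1) k).ι ≫ x = a ≫ π := by
      have := (fibrations_iff _).1 hX n k
      have sq : CommSq (a ≫ π) (horn.{u} (n + 1) k).ι (terminal.from X) (terminal.from _) :=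
        ⟨terminal.hom_ext _ _⟩
      exact ⟨sq.lift, sq.fac_left⟩
    obtain ⟨l, hl, hl'⟩ := exists_path_lift hY k (a ≫ pullback.snd _ _) ![x ≫ f, b] (fun ε => by
      fin_cases ε
      · refine (Category.assoc _ _ _).trans ?_
        refine (congrArg (a ≫ ·) pullback.condition.symm).trans ?_
        change a ≫ π ≫ f = (horn.{u} (n + 1) k).ι ≫ x ≫ f
        rw [reassoc_of% hx]
      · exact (Category.assoc _ _ _).trans sq.w)
    have w : x ≫ f = l ≫ pathEval Y 0 := (hl' 0).symm
    refine ⟨⟨pullback.lift x l w, ?_, ?_⟩⟩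
    · apply pullback.hom_ext
      · rw [Category.assoc, pullback.lift_fst, hx]
      · rw [Category.assoc, pullback.lift_snd, hl]
    · rw [pullback.lift_snd_assoc]
      exact hl' 1
  · rw [pullback.lift_snd_assoc, Category.assoc, comp_pathEval, ofPath_toPath, hc₁,
      Category.comp_id]

end SemiSSet

/-! ### The axioms of a fibration category -/

namespace FibrantSemiSSet

open SemiSSet

/-- The homotopy relation on maps between fibrant semisimplicial sets. -/
def homotopyRel : HomRel FibrantSemiSSet.{u} := fun _ _ f g => Homotopic f.hom g.hom

instance congruence_homotopyRel : Congruence homotopyRel.{u} where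
  equivalence {_ Y} :=
    ⟨fun f => Homotopic.refl Y.property f.hom, Homotopic.symm Y.property,
      Homotopic.trans Y.property⟩
  comp_left f _ _ h := Homotopic.precomp h f.hom
  comp_right g h := Homotopic.postcomp h g.hom

lemma weakEquivalences_iff {X Y : FibrantSemiSSet.{u}} (f : X ⟶ Y) :
    weakEquivalences f ↔ IsIso ((Quotient.functor homotopyRel).map f) := by
  constructor
  · rintro ⟨g, h₁, h₂⟩
    exact ⟨(Quotient.functor homotopyRel).map (ObjectProperty.homMk g),
      CategoryTheory.Quotient.sound homotopyRel (f₁ := f ≫ ObjectProperty.homMk g) (f₂ := 𝟙 X) h₁,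
      CategoryTheory.Quotient.sound homotopyRel (f₁ := ObjectProperty.homMk g ≫ f) (f₂ := 𝟙 Y) h₂⟩
  · rintro ⟨g, h₁, h₂⟩
    obtain ⟨g, rfl⟩ := (Quotient.functor homotopyRel).map_surjective g
    exact ⟨g.hom, (Quotient.functor_map_eq_iff homotopyRel (f ≫ g) (𝟙 X)).1 h₁,
      (Quotient.functor_map_eq_iff homotopyRel (g ≫ f) (𝟙 Y)).1 h₂⟩

lemma weakEquivalences_eq :
    weakEquivalences.{u} =
      (MorphismProperty.isomorphisms _).inverseImage (Quotient.functor homotopyRel) := by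
  ext X Y f
  exact weakEquivalences_iff f

lemma isMultiplicative_weakEquivalences : weakEquivalences.{u}.IsMultiplicative := by
  rw [weakEquivalences_eq]
  infer_instance

/-- The middle map g acquires a section from f ≫ g and a retraction from g ≫ h, so it is invertible;
the outer maps follow by cancellation. -/
lemma isIso_of_isIso_comp_comp {C : Type v} [Category.{w} C] {A B D E : C} (f : A ⟶ B) (g : B ⟶ D)
    (h : D ⟶ E) (hfg : IsIso (f ≫ g)) (hgh : IsIso (g ≫ h)) : IsIso f ∧ IsIso g ∧ IsIso h := by
  have : IsSplitEpi g := IsSplitEpi.mk' ⟨inv (f ≫ g) ≫ f, by simp⟩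
  have : IsSplitMono g := IsSplitMono.mk' ⟨h ≫ inv (g ≫ h), by rw [← Category.assoc, IsIso.hom_inv_id]⟩
  have hg : IsIso g := isIso_of_mono_of_isSplitEpi g
  exact ⟨IsIso.of_isIso_comp_right f g, hg, IsIso.of_isIso_comp_left g h⟩

lemma weakEquivalences_two_of_six {A B C D : FibrantSemiSSet.{u}} (f : A ⟶ B) (g : B ⟶ C)
    (h : C ⟶ D) (hfg : weakEquivalences (f ≫ g)) (hgh : weakEquivalences (g ≫ h)) :
    weakEquivalences f ∧ weakEquivalences g ∧ weakEquivalences h ∧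
      weakEquivalences (f ≫ g ≫ h) := by
  simp only [weakEquivalences_iff, CategoryTheory.Functor.map_comp] at hfg hgh ⊢
  obtain ⟨hf, hg, hh⟩ := isIso_of_isIso_comp_comp _ _ _ hfg hgh
  exact ⟨hf, hg, hh, inferInstance⟩

lemma isFibrant_terminal : IsFibrant (⊤_ SemiSSet.{u}) := by
  rw [IsFibrant, show terminal.from (⊤_ SemiSSet.{u}) = 𝟙 _ from terminal.hom_ext _ _]
  exact SemiSSet.fibrations.id_mem _

/-- The point as a fibrant semisimplicial set. -/
noncomputable def point : FibrantSemiSSet.{u} := ⟨⊤_ SemiSSet.{u}, isFibrant_terminal⟩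

/-- The point is terminal. -/
noncomputable def isTerminalPoint : IsTerminal point.{u} :=
  IsTerminal.ofUniqueHom (fun X => ObjectProperty.homMk (terminal.from X.obj))
    fun _ _ => ObjectProperty.hom_ext _ (terminal.hom_ext _ _)

lemma fibrations_of_isTerminal {T : FibrantSemiSSet.{u}} (hT : IsTerminal T) {X : FibrantSemiSSet}
    (f : X ⟶ T) : fibrations f := by
  let e := hT.uniqueUpToIso isTerminalPoint
  refine (MorphismProperty.cancel_right_of_respectsIso SemiSSet.fibrations f.hom e.hom.hom).1 ?_
  rw [show f.hom ≫ e.hom.hom = terminal.from X.obj from terminal.hom_ext _ _]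
  exact X.property

lemma exists_isPullback {X Y S : FibrantSemiSSet.{u}} (f : X ⟶ S) (p : Y ⟶ S) (hp : fibrations p) :
    ∃ (P : FibrantSemiSSet.{u}) (fst : P ⟶ X) (snd : P ⟶ Y), IsPullback fst snd f p ∧
      IsPullback fst.hom snd.hom f.hom p.hom := by
  have h := IsPullback.of_hasPullback f.hom p.hom
  have hP : IsFibrant (pullback f.hom p.hom) :=
    IsFibrant.of_fibrations (MorphismProperty.pullback_fst (P := SemiSSet.fibrations) _ _ hp)
      X.property
  let P : FibrantSemiSSet.{u} := ⟨_, hP⟩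
  let fst : P ⟶ X := ObjectProperty.homMk (pullback.fst f.hom p.hom)
  let snd : P ⟶ Y := ObjectProperty.homMk (pullback.snd f.hom p.hom)
  exact ⟨P, fst, snd, IsPullback.of_map IsFibrant.ι (ObjectProperty.hom_ext _ h.w) h, h⟩

/-- The ambient pullback along a fibration is fibrant, so it is also a pullback in the full
subcategory, and every other one there is isomorphic to it. -/
lemma isPullback_hom {P X Y S : FibrantSemiSSet.{u}} {fst : P ⟶ X} {snd : P ⟶ Y} {f : X ⟶ S}
    {p : Y ⟶ S} (h : IsPullback fst snd f p) (hp : fibrations p) :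
    IsPullback fst.hom snd.hom f.hom p.hom := by
  obtain ⟨P', fst', snd', h₁, h₂⟩ := exists_isPullback f p hp
  let e := h.isoIsPullback _ _ h₁
  refine h₂.of_iso (IsFibrant.ι.mapIso e.symm) (Iso.refl _) (Iso.refl _) (Iso.refl _) ?_ ?_ ?_ ?_
  · refine (Category.comp_id _).trans ?_
    exact congrArg (·.hom) (h.isoIsPullback_inv_fst _ _ h₁).symm
  · refine (Category.comp_id _).trans ?_
    exact congrArg (·.hom) (h.isoIsPullback_inv_snd _ _ h₁).symm
  · exact (Category.comp_id _).trans (Category.id_comp _).symm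
  · exact (Category.comp_id _).trans (Category.id_comp _).symm

lemma isStableUnderBaseChange_fibrations : fibrations.{u}.IsStableUnderBaseChange where
  of_isPullback sq hg := SemiSSet.fibrations.of_isPullback (isPullback_hom sq.flip hg).flip hg

/-- A right lifting property is automatically stable under pullback; this description avoids pulling
back homotopy inverses by hand. -/
lemma trivialFibrations_iff {X Y : FibrantSemiSSet.{u}} (f : X ⟶ Y) :
    (fibrations ⊓ weakEquivalences) f ↔ (MorphismProperty.monomorphisms SemiSSet.{u}).rlp f.hom :=
  ⟨fun h => rlp_monomorphisms_of_homotopyEquivalence X.property Y.property h.1 h.2, fun h =>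
    ⟨fibrations_of_rlp_monomorphisms h, homotopyEquivalences_of_rlp_monomorphisms Y.property h⟩⟩

lemma isStableUnderBaseChange_trivialFibrations :
    (fibrations.{u} ⊓ weakEquivalences).IsStableUnderBaseChange where
  of_isPullback sq hg := by
    rw [trivialFibrations_iff]
    exact MorphismProperty.of_isPullback (isPullback_hom sq.flip hg.1).flip
      ((trivialFibrations_iff _).1 hg)

end FibrantSemiSSet

theorem mainTheorem6 :
    IsFibrationCategory FibrantSemiSSet.weakEquivalences.{u} FibrantSemiSSet.fibrations.{u} where
  weq_isMultiplicative := FibrantSemiSSet.isMultiplicative_weakEquivalences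
  weq_of_isIso f _ := (FibrantSemiSSet.weakEquivalences_iff f).2 inferInstance
  fib_isMultiplicative :=
    inferInstanceAs (SemiSSet.fibrations.inverseImage SemiSSet.IsFibrant.ι).IsMultiplicative
  fib_of_isIso f _ := SemiSSet.fibrations.of_isIso f.hom
  hasTerminal := FibrantSemiSSet.isTerminalPoint.hasTerminal
  fib_to_terminal hT _ f := FibrantSemiSSet.fibrations_of_isTerminal hT f
  hasPullback f p hp := by
    obtain ⟨_, _, _, h, -⟩ := FibrantSemiSSet.exists_isPullback f p hp
    exact h.hasPullback
  fib_pullback := FibrantSemiSSet.isStableUnderBaseChange_fibrations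
  trivFib_pullback := FibrantSemiSSet.isStableUnderBaseChange_trivialFibrations
  factorization {X Y} f := by
    obtain ⟨Z, i, p, hZ, hi, hp, h⟩ := SemiSSet.exists_factorization X.property Y.property f.hom
    exact ⟨⟨Z, hZ⟩, ObjectProperty.homMk i, ObjectProperty.homMk p, hi, hp,
      ObjectProperty.hom_ext _ h⟩
  weq_two_of_six := FibrantSemiSSet.weakEquivalences_two_of_six
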